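/- Let $G=(V,E)$ be a finite simple connected graph, $B\subseteq V$ (possibly empty), $V^\circ=V\setminus B$, and let $J=(J_e)_{e\in E}$ be i.i.d. standard Gaussian random variables. The Edwards--Anderson Hamiltonian is $H_J(\sigma)=-\sum_{\{i,j\}\in E}J_{ij}\sigma_i\sigma_j$ for $\sigma\in\{-1,1\}^V$. A ground state under the boundary condition $\gamma\in\{-1,1\}^B$ is a minimizer $\sigma$ of $H_J$ among the configurations with $\sigma_i=\gamma_i$ for all $i\in B$ (no constraint if $B=\emptyset$); in the cases below it is almost surely unique, up to a global sign if $B=\emptyset$. For $A\subseteq V^\circ$ let $\Delta(A)$ be $H_J$ of the configuration obtained from the ground state $\sigma$ by flipping all spins in $A$, minus $H_J(\sigma)$, and let $\partial A$ be the set of edges from $A$ to $V\setminus A$. Define $$F:=\min\Bigl\{\frac{\Delta(A)}{|\partial A|}:\ A\subseteq V^\circ,\ \tfrac14|V^\circ|\le|A|\le\tfrac34|V^\circ|\Bigr\}$$ (the ratio being $0$ if $\partial A=\emptyset$). There is a universal constant $C_1>0$, and for every $d\ge1$ a constant $C_2>0$ depending only on $d$, such that the following hold. 1. (Usual boundary.)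 Let $L\ge3$, let $V=\{0,1,\ldots,L\}^d$ with the nearest-neighbour edges, and let $B$ be the set of vertices with at least one coordinate equal to $0$ or $L$. For every fixed boundary condition $\gamma\in\{-1,1\}^B$ and every $K>0$, $$\mathbb P\bigl(F\ge C_1KL^{-1/2}\sqrt{\log L}\bigr)\le C_2K^{-2}.$$ 2. (Free or periodic boundary.) Let $L\ge2$ and $B=\emptyset$, and let $G$ be either $\{0,1,\ldots,L\}^d$ with the nearest-neighbour edges, or the cube with opposite faces identified, i.e. $(\mathbb Z/L\mathbb Z)^d$ with an edge between two distinct vertices whenever they differ by $\pm1$ in exactly one coordinate and agree in the others. Then for every $K>0$, $$\mathbb P\bigl(F\ge C_1KL^{-1/2}\sqrt{\log L}\bigr)\le C_2K^{-\max(2,d)},$$ that is, $C_2K^{-2}$ for $d\le2$, improving to $C_2K^{-d}$ for $d\ge3$. -/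

import Mathlib

open MeasureTheory ProbabilityTheory

namespace EdwardsAnderson

noncomputable section

variable {V : Type*}

/-- The product `σ_x σ_y` of the spins at the two ends of the edge `e = {x, y}`. -/
def bond (σ : V → ℤˣ) (e : Sym2 V) : ℝ :=
  (((e.map σ).mul : ℤˣ) : ℤ)

open Classical in
/-- The Edwards–Anderson Hamiltonian `H_J(σ) = - ∑_{{x,y} ∈ E} J_{xy} σ_x σ_y`; the spin space
`{-1, 1}` is the group of units of `ℤ`. -/
def hamiltonian [Fintype V] (G : SimpleGraph V) (J : G.edgeSet → ℝ) (σ : V → ℤˣ) : ℝ :=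
  -∑ e : G.edgeSet, J e * bond σ e

/-- `σ` minimizes `H_J` among the configurations that agree with `γ` on `B`. For `B = ∅` this is
a ground state with free boundary condition. -/
def IsGroundState [Fintype V] (G : SimpleGraph V) (B : Set V) (γ : B → ℤˣ)
    (J : G.edgeSet → ℝ) (σ : V → ℤˣ) : Prop :=
  (∀ x : B, σ x = γ x) ∧
    ∀ τ : V → ℤˣ, (∀ x : B, τ x = γ x) → hamiltonian G J σ ≤ hamiltonian G J τ

open Classical in
/-- Overturn all spins in `A`. -/
def overturn (A : Set V) (σ : V → ℤˣ) : V → ℤˣ :=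
  fun x => if x ∈ A then -σ x else σ x

/-- The energy cost `Δ(A)` of overturning all spins in `A` in the configuration `σ`. -/
def energyCost [Fintype V] (G : SimpleGraph V) (J : G.edgeSet → ℝ) (σ : V → ℤˣ)
    (A : Set V) : ℝ :=
  hamiltonian G J (overturn A σ) - hamiltonian G J σ

/-- The edge boundary `∂A`: all edges from `A` to its complement. -/
def edgeBoundary (G : SimpleGraph V) (A : Set V) : Set (Sym2 V) :=
  {e | e ∈ G.edgeSet ∧ ∃ x ∈ A, ∃ y ∉ A, e = s(x, y)}

/-- The regions `A ⊆ V° = V \ B` with `|V°| / 4 ≤ |A| ≤ 3 |V°| / 4`. -/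
def macroscopicRegions (B : Set V) : Set (Set V) :=
  {A | A ⊆ Bᶜ ∧ (Bᶜ.ncard : ℝ) / 4 ≤ A.ncard ∧ (A.ncard : ℝ) ≤ 3 * (Bᶜ.ncard : ℝ) / 4}

/-- `F`, the minimum of `Δ(A) / |∂A|` over the macroscopic regions `A` (a finite family, which is
nonempty as soon as `|V°| ≥ 2`). The ratio is `0` when `∂A` is empty. -/
def minCostRatio [Fintype V] (G : SimpleGraph V) (B : Set V) (J : G.edgeSet → ℝ)
    (σ : V → ℤˣ) : ℝ :=
  sInf ((fun A => energyCost G J σ A / ((edgeBoundary G A).ncard : ℝ)) '' macroscopicRegions B)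

/-- On the probability space `(Ω, P)`, the disorder `J = (J_e)_{e ∈ E}` consists of i.i.d. standard
Gaussian random variables, and `σ` is almost surely a ground state in the environment `J` under
the boundary condition `γ` on `B`. -/
structure IsRandomGroundState [Fintype V] {Ω : Type*} [MeasurableSpace Ω] (P : Measure Ω)
    (G : SimpleGraph V) (B : Set V) (γ : B → ℤˣ) (J : Ω → G.edgeSet → ℝ)
    (σ : Ω → V → ℤˣ) : Prop where
  hasLaw : ∀ e, HasLaw (fun ω => J ω e) (gaussianReal 0 1) P
  indep : iIndepFun (fun e ω => J ω e) P
  ground : ∀ᵐ ω ∂P, IsGroundState G B γ (J ω) (σ ω)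

/-- The cube `{0, 1, …, L}^d` with nearest-neighbour edges. -/
def cube (d L : ℕ) : SimpleGraph (Fin d → Fin (L + 1)) :=
  SimpleGraph.fromRel fun x y => ∃ i, (y i : ℕ) = (x i : ℕ) + 1 ∧ ∀ j ≠ i, y j = x j

/-- The usual boundary of the cube: some coordinate is `0` or `L`. -/
def cubeBoundary (d L : ℕ) : Set (Fin d → Fin (L + 1)) :=
  {x | ∃ i, (x i : ℕ) = 0 ∨ (x i : ℕ) = L}

/-- The cube with opposite faces identified: the vertex set is `(ℤ/L)^d`, and two distinct vertices
are adjacent when they differ by `±1` in exactly one coordinate. -/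
def torus (d L : ℕ) : SimpleGraph (Fin d → ZMod L) :=
  SimpleGraph.fromRel fun x y => ∃ i, y i = x i + 1 ∧ ∀ j ≠ i, y j = x j

end

end EdwardsAnderson

open scoped NNReal

namespace EdwardsAnderson

noncomputable section

/-! Write the disorder as `J = X + Y` and resample a small part of it, `J' = X + Y'`, with `X`, `Y`,
`Y'` independent Gaussian of variances `N/(N+1)`, `1/(N+1)`, `1/(N+1)` on every edge. Let `σ`, `τ`
be ground states for `J`, `J'`, and `R` the sum of `σ_x τ_x` over `V°`.

If `|R| ≤ |V°|/2`, the region `A = {σ ≠ τ}` is macroscopic. Flipping `A` turns `σ` into `τ`, which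
minimizes `H_{J'}`, so the cost of `A` under `J` is at most its cost under `J - J' = Y - Y'`, hence
at most `2 max|Y - Y'| |∂A|` (`le_of_overlap_le`). So `F ≥ t` forces a large overlap or a large
fresh coupling. The latter is a Gaussian tail; the former is controlled by Markov's inequality for
`R²` (`costlyEnvironments_real_le_correlation`).

The second moment of `R` is a sum over pairs `i, j` of correlations of `σ_i σ_j` between the two
environments. Reversing the couplings on `∂A` and the spins in `A` preserves the energy, so `σ_i
σ_j` is odd in the couplings of `∂A` whenever `A ⊆ V°` contains `i` but not `j`. Balls around `i`
give `m` disjoint cuts of this kind, if `m` is at most the distance from `i` to `j` and to `B`. For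
a function odd in a block of couplings, the correlation vanishes when no noise is shared on the
block, and it is convex in the amount shared; sharing the proportion `N/(N+1)` instead of everything
therefore gains a factor `N/(N+1)`. Treating the blocks one after the other gives `(N/(N+1))^m`
(`correlation_le_pow`).

Summing geometric series, the mean of `(R/|V°|)²` is of order `((N+1)/L)^d` without boundary, and of
order `(N+1)/L` with boundary, where the sites close to `B` limit the rate. Taking `N + 1` close to
`12dL/K²` makes the fresh couplings small compared with `t` and gives the powers `K^(-2d)` and
`K^(-2)`. When `K² ≥ 12dL`, the crude bound `F ≤ 2 max|J|` is enough. -/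

/-- The law of a vector of independent centred Gaussian variables with variances `v`. -/
def gaussianVector {ι : Type*} [Fintype ι] (v : ι → ℝ≥0) : Measure (ι → ℝ) :=
  Measure.pi fun e => gaussianReal 0 (v e)

instance {ι : Type*} [Fintype ι] (v : ι → ℝ≥0) : IsProbabilityMeasure (gaussianVector v) := by
  unfold gaussianVector; infer_instance

/-- The heat semigroup `f ↦ E f(x + Y)`, where `Y` has independent centred Gaussian
coordinates with variances `w`. -/
def heat {ι : Type*} [Fintype ι] (w : ι → ℝ≥0) (f : (ι → ℝ) → ℝ) (x : ι → ℝ) : ℝ :=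
  ∫ y, f (x + y) ∂gaussianVector w

/-- `E f(X + Y) f(X + Y')`, where `X`, `Y`, `Y'` are independent Gaussian vectors with
variances `v`, `w`, `w`. -/
def correlation {ι : Type*} [Fintype ι] (f : (ι → ℝ) → ℝ) (v w : ι → ℝ≥0) : ℝ :=
  ∫ x, heat w f x ^ 2 ∂gaussianVector v

/-! ### Gaussian noise: convexity of correlations and decay for functions odd in many blocks. -/

section Gaussian

variable {ι : Type*} [Fintype ι]

lemma measurePreserving_add_gaussianVector (v w : ι → ℝ≥0) :
    MeasurePreserving (fun p : (ι → ℝ) × (ι → ℝ) => p.1 + p.2)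
      ((gaussianVector v).prod (gaussianVector w)) (gaussianVector (v + w)) := by
  have h1 := (measurePreserving_arrowProdEquivProdArrow ℝ ℝ ι
    (fun e => gaussianReal 0 (v e)) (fun e => gaussianReal 0 (w e))).symm
  have h2 : MeasurePreserving (fun (p : ι → ℝ × ℝ) e => (p e).1 + (p e).2)
      (Measure.pi fun e => (gaussianReal 0 (v e)).prod (gaussianReal 0 (w e)))
      (gaussianVector (v + w)) := by
    have h3 : ∀ e, MeasurePreserving (fun p : ℝ × ℝ => p.1 + p.2)
        ((gaussianReal 0 (v e)).prod (gaussianReal 0 (w e))) (gaussianReal 0 ((v + w) e)) := by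
      refine fun e => ⟨by fun_prop, ?_⟩
      have := gaussianReal_conv_gaussianReal (m₁ := 0) (m₂ := 0) (v₁ := v e) (v₂ := w e)
      simpa [Measure.conv] using this
    exact measurePreserving_pi _ _ h3
  exact h2.comp h1

lemma map_add_gaussianVector (v w : ι → ℝ≥0) :
    ((gaussianVector v).prod (gaussianVector w)).map (fun p => p.1 + p.2)
      = gaussianVector (v + w) :=
  (measurePreserving_add_gaussianVector v w).map_eq

lemma integrable_of_bound {α : Type*} [MeasurableSpace α] {μ : Measure α} [IsFiniteMeasure μ]
    {f : α → ℝ} (hf : Measurable f) {C : ℝ} (hC : ∀ x, |f x| ≤ C) : Integrable f μ :=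
  Integrable.of_bound hf.aestronglyMeasurable C (Filter.Eventually.of_forall hC)

lemma abs_integral_le_of_bound {α : Type*} [MeasurableSpace α] {μ : Measure α}
    [IsProbabilityMeasure μ] {f : α → ℝ} {C : ℝ} (hC : ∀ x, |f x| ≤ C) :
    |∫ x, f x ∂μ| ≤ C := by
  have := norm_integral_le_of_norm_le_const (μ := μ) (f := f) (C := C)
    (Filter.Eventually.of_forall hC)
  simpa using this

lemma integral_gaussianVector_add (v w : ι → ℝ≥0) {f : (ι → ℝ) → ℝ} (hf : Measurable f)
    {C : ℝ} (hC : ∀ x, |f x| ≤ C) :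
    ∫ x, f x ∂gaussianVector (v + w) = ∫ x, heat w f x ∂gaussianVector v := by
  rw [← map_add_gaussianVector, integral_map (by fun_prop) hf.aestronglyMeasurable,
    integral_prod]
  · rfl
  · exact integrable_of_bound (hf.comp (by fun_prop)) (fun _ => hC _)

lemma measurable_heat (w : ι → ℝ≥0) {f : (ι → ℝ) → ℝ} (hf : Measurable f) :
    Measurable (heat w f) := by
  have : Measurable fun p : (ι → ℝ) × (ι → ℝ) => f (p.1 + p.2) := hf.comp (by fun_prop)
  exact (this.stronglyMeasurable.integral_prod_right' (ν := gaussianVector w)).measurable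

lemma abs_heat_le (w : ι → ℝ≥0) {f : (ι → ℝ) → ℝ} {C : ℝ} (hC : ∀ x, |f x| ≤ C) (x : ι → ℝ) :
    |heat w f x| ≤ C :=
  abs_integral_le_of_bound fun _ => hC _

lemma heat_add (v w : ι → ℝ≥0) {f : (ι → ℝ) → ℝ} (hf : Measurable f)
    {C : ℝ} (hC : ∀ x, |f x| ≤ C) : heat (v + w) f = heat v (heat w f) := by
  funext x
  unfold heat
  have := integral_gaussianVector_add v w (f := fun y => f (x + y)) (hf.comp (by fun_prop))
    (fun _ => hC _)
  rw [this]
  simp only [heat, add_assoc]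

lemma integral_sub_add {α : Type*} [MeasurableSpace α] {μ : Measure α} {f g h : α → ℝ}
    (hf : Integrable f μ) (hg : Integrable g μ) (hh : Integrable h μ) :
    ∫ x, (f x - g x + h x) ∂μ = ∫ x, f x ∂μ - ∫ x, g x ∂μ + ∫ x, h x ∂μ := by
  have h1 : ∫ x, (f x - g x) ∂μ = ∫ x, f x ∂μ - ∫ x, g x ∂μ := integral_sub hf hg
  rw [← h1]
  exact integral_add (hf.sub hg) hh

/-- For an exchangeable function of two independent variables, the variance of the conditional
mean is at most half the total variance. -/
lemma two_mul_integral_sq_le {α : Type*} [MeasurableSpace α] (ν : Measure α)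
    [IsProbabilityMeasure ν] {u : α → α → ℝ} (hu : Measurable (Function.uncurry u))
    {C : ℝ} (hC : ∀ x y, |u x y| ≤ C) (hsymm : ∀ x y, u x y = u y x) :
    2 * ∫ y, (∫ z, u y z ∂ν) ^ 2 ∂ν
      ≤ ∫ y, (∫ z, u y z ^ 2 ∂ν) ∂ν + (∫ y, (∫ z, u y z ∂ν) ∂ν) ^ 2 := by
  set a : α → ℝ := fun y => ∫ z, u y z ∂ν with ha
  set c := ∫ y, a y ∂ν with hc
  have hC0 : 0 ≤ C := by
    obtain ⟨x⟩ : Nonempty α := nonempty_of_isProbabilityMeasure ν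
    exact (abs_nonneg _).trans (hC x x)
  have ham : Measurable a := (hu.stronglyMeasurable.integral_prod_right' (ν := ν)).measurable
  have hab : ∀ y, |a y| ≤ C := fun y => abs_integral_le_of_bound fun _ => hC _ _
  have hum : ∀ y, Measurable (u y) := fun y => hu.comp measurable_prodMk_left
  have hsq : ∀ {t : ℝ}, |t| ≤ C → |t ^ 2| ≤ C ^ 2 := fun {t} h => by
    rw [abs_pow]; exact pow_le_pow_left₀ (abs_nonneg _) h 2
  have hai := integrable_of_bound (μ := ν) ham hab
  have ha2i := integrable_of_bound (μ := ν) (ham.pow_const 2) (fun x => hsq (hab x))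
  have hui := fun y => integrable_of_bound (μ := ν) (hum y) (hC y)
  have hu2i := fun y => integrable_of_bound (μ := ν) ((hum y).pow_const 2)
    (fun x => hsq (hC y x))
  -- Centre by `a y`, which has mean `c`, before applying Jensen in `y`. After expansion and
  -- averaging over `z`, the right side is `E u² - 2 E(u a) + E a²`, and symmetry of `u` makes the
  -- cross term equal to `E a²`.
  have key : ∀ z, ((a z - c) ^ 2) ≤ ∫ y, (u z y - a y) ^ 2 ∂ν := by
    intro z
    have h1 : a z - c = ∫ y, (u z y - a y) ∂ν := by
      rw [integral_sub (hui z) hai]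
    rw [h1]
    have hm : MemLp (fun y => u z y - a y) 2 ν := by
      refine MemLp.of_bound ((hum z).sub ham).aestronglyMeasurable (C + C)
        (Filter.Eventually.of_forall fun y => ?_)
      exact (norm_sub_le _ _).trans (add_le_add (hC _ _) (hab _))
    have := variance_nonneg (fun y => u z y - a y) ν
    rw [variance_eq_sub hm] at this
    simpa using sub_nonneg.1 this
  have hmain : ∀ z, (a z - c) ^ 2 ≤ ∫ y, u z y ^ 2 ∂ν - 2 * ∫ y, u z y * a y ∂ν
      + ∫ y, a y ^ 2 ∂ν := by
    intro z
    refine (key z).trans_eq ?_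
    have hi : Integrable (fun y => u z y * a y) ν :=
      integrable_of_bound (C := C * C) ((hum z).mul ham) (fun y => by
        rw [abs_mul]; exact mul_le_mul (hC _ _) (hab _) (abs_nonneg _) hC0)
    rw [← integral_const_mul, ← integral_sub_add (hu2i z) (hi.const_mul 2) ha2i]
    congr 1; funext y; ring
  have hUm : Measurable fun z => ∫ y, u z y ^ 2 ∂ν :=
    ((hu.pow_const 2).stronglyMeasurable.integral_prod_right' (ν := ν)).measurable
  have hUi : Integrable (fun z => ∫ y, u z y ^ 2 ∂ν) ν :=
    integrable_of_bound (C := C ^ 2) hUm fun z => abs_integral_le_of_bound fun _ => hsq (hC _ _)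
  have hWm' : Measurable fun p : α × α => u p.1 p.2 * a p.2 := hu.mul (ham.comp measurable_snd)
  have hWb : ∀ z y, |u z y * a y| ≤ C * C := fun z y => by
    rw [abs_mul]; exact mul_le_mul (hC _ _) (hab _) (abs_nonneg _) hC0
  have hWm : Measurable fun z => ∫ y, u z y * a y ∂ν :=
    (hWm'.stronglyMeasurable.integral_prod_right' (ν := ν)).measurable
  have hWi : Integrable (fun z => ∫ y, u z y * a y ∂ν) ν :=
    integrable_of_bound (C := C * C) hWm fun z => abs_integral_le_of_bound fun _ => hWb _ _
  have hW : ∫ z, ∫ y, u z y * a y ∂ν ∂ν = ∫ y, a y ^ 2 ∂ν := by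
    rw [integral_integral_swap]
    · congr 1; funext y
      rw [integral_mul_const, sq]
      congr 1
      simp only [ha]
      congr 1; funext z; exact hsymm _ _
    · exact integrable_of_bound hWm' (fun p => hWb p.1 p.2)
  have hL : ∫ z, (a z - c) ^ 2 ∂ν = ∫ z, a z ^ 2 ∂ν - c ^ 2 := by
    have : ∀ z, (a z - c) ^ 2 = a z ^ 2 - 2 * c * a z + c ^ 2 := fun z => by ring
    simp_rw [this]
    rw [integral_sub_add ha2i (hai.const_mul _) (integrable_const _), integral_const_mul, ← hc]
    simp; ring
  have hLi : Integrable (fun z => (a z - c) ^ 2) ν := by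
    refine integrable_of_bound (C := (C + |c|) ^ 2) ((ham.sub_const c).pow_const 2) fun z => ?_
    rw [abs_pow]
    exact pow_le_pow_left₀ (abs_nonneg _)
      ((abs_sub _ _).trans (add_le_add (hab z) le_rfl)) 2
  have hI := integral_mono hLi ((hUi.sub (hWi.const_mul 2)).add (integrable_const _)) hmain
  simp only [Pi.add_apply, Pi.sub_apply] at hI
  rw [integral_sub_add hUi (hWi.const_mul 2) (integrable_const _), integral_const_mul, hW,
    hL] at hI
  simp only [integral_const, probReal_univ, smul_eq_mul, one_mul] at hI
  linarith

lemma abs_sq_le {t C : ℝ} (h : |t| ≤ C) : |t ^ 2| ≤ C ^ 2 := by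
  rw [abs_pow]; exact pow_le_pow_left₀ (abs_nonneg _) h 2

/-- Convexity of the correlation in the strength of the common part of the noise. -/
lemma two_mul_correlation_le {f : (ι → ℝ) → ℝ} (hf : Measurable f) {C : ℝ}
    (hC : ∀ x, |f x| ≤ C) (v w h : ι → ℝ≥0) :
    2 * correlation f (v + h) (h + w)
      ≤ correlation f (v + h + h) w + correlation f v (h + (h + w)) := by
  set g := heat w f with hg
  have hgm : Measurable g := measurable_heat w hf
  have hgC : ∀ x, |g x| ≤ C := abs_heat_le w hC
  have hg2 : ∀ x, |g x ^ 2| ≤ C ^ 2 := fun x => abs_sq_le (hgC x)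
  have hhgm := measurable_heat h hgm
  have hhgC := abs_heat_le h hgC
  have e1 : correlation f (v + h + h) w
      = ∫ x, heat h (heat h fun t => g t ^ 2) x ∂gaussianVector v := by
    unfold correlation
    rw [integral_gaussianVector_add _ _ (hgm.pow_const 2) hg2,
      integral_gaussianVector_add _ _ (measurable_heat h (hgm.pow_const 2))
        (abs_heat_le h hg2)]
  have e2 : correlation f (v + h) (h + w)
      = ∫ x, heat h (fun t => heat h g t ^ 2) x ∂gaussianVector v := by
    unfold correlation
    rw [heat_add h w hf hC,
      integral_gaussianVector_add _ _ (hhgm.pow_const 2) (fun x => abs_sq_le (hhgC x))]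
  have e3 : correlation f v (h + (h + w)) = ∫ x, heat h (heat h g) x ^ 2 ∂gaussianVector v := by
    unfold correlation
    rw [heat_add h _ hf hC, heat_add h w hf hC]
  rw [e1, e2, e3, ← integral_const_mul, ← integral_add]
  · refine integral_mono ?_ ?_ fun x => ?_
    · exact (integrable_of_bound (measurable_heat h (hhgm.pow_const 2))
        (abs_heat_le h fun x => abs_sq_le (hhgC x))).const_mul 2
    · exact (integrable_of_bound (measurable_heat h (measurable_heat h (hgm.pow_const 2)))
        (abs_heat_le h (abs_heat_le h hg2))).add
        (integrable_of_bound ((measurable_heat h hhgm).pow_const 2)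
          fun x => abs_sq_le (abs_heat_le h hhgC x))
    -- The two independent increments of variance `h` enter only through their sum, so `g (x + y +
    -- z)` is symmetric in them. Sharing both, one or none of them gives the three correlations.
    · have := two_mul_integral_sq_le (gaussianVector h) (u := fun y z => g (x + y + z))
        (hgm.comp (by fun_prop)) (fun y z => hgC _) (fun y z => by rw [add_right_comm])
      simpa only [heat, Pi.add_apply] using this
  · exact integrable_of_bound (measurable_heat h (measurable_heat h (hgm.pow_const 2)))
        (abs_heat_le h (abs_heat_le h hg2))
  · exact integrable_of_bound ((measurable_heat h hhgm).pow_const 2)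
          fun x => abs_sq_le (abs_heat_le h hhgC x)

open Classical in
/-- Change the signs of the coordinates in `S`. -/
def flipSigns {ι : Type*} (S : Set ι) (x : ι → ℝ) : ι → ℝ :=
  fun e => if e ∈ S then -x e else x e

lemma measurePreserving_flipSigns (S : Set ι) (w : ι → ℝ≥0) :
    MeasurePreserving (flipSigns S) (gaussianVector w) (gaussianVector w) := by
  classical
  have h : ∀ e, MeasurePreserving (fun t : ℝ => if e ∈ S then -t else t)
      (gaussianReal 0 (w e)) (gaussianReal 0 (w e)) := by
    intro e
    by_cases he : e ∈ S
    · simp only [he, if_true]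
      refine ⟨by fun_prop, ?_⟩
      rw [gaussianReal_map_neg, neg_zero]
    · simp only [he, if_false]
      exact MeasurePreserving.id _
  have := measurePreserving_pi (fun e => gaussianReal 0 (w e)) (fun e => gaussianReal 0 (w e)) h
  exact this

/-- At a point vanishing on `S`, flipping the signs of the noise on `S` flips those of the whole
argument. The noise is symmetric, so the average equals its own negative. -/
lemma heat_eq_zero {f : (ι → ℝ) → ℝ} (hf : Measurable f) {S : Set ι}
    (hS : ∀ x, f (flipSigns S x) = -f x) (w : ι → ℝ≥0) {x : ι → ℝ} (hx : ∀ e ∈ S, x e = 0) :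
    heat w f x = 0 := by
  have h1 : heat w f x = ∫ y, f (x + flipSigns S y) ∂gaussianVector w := by
    have hp := measurePreserving_flipSigns S w
    have hm : Measurable fun y => f (x + y) := hf.comp (by fun_prop)
    conv_lhs => rw [heat, ← hp.map_eq]
    rw [integral_map hp.measurable.aemeasurable hm.aestronglyMeasurable]
  have h2 : ∀ y, f (x + flipSigns S y) = -f (x + y) := by
    intro y
    rw [← hS]
    congr 1
    funext e
    by_cases he : e ∈ S <;> simp [flipSigns, he, hx]
  simp_rw [h2, integral_neg] at h1
  unfold heat at h1 ⊢
  linarith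

lemma ae_gaussianVector_eq_zero {S : Set ι} {v : ι → ℝ≥0} (hv : ∀ e ∈ S, v e = 0) :
    ∀ᵐ x ∂gaussianVector v, ∀ e ∈ S, x e = 0 := by
  rw [ae_all_iff]
  intro e
  by_cases he : e ∈ S
  · have h := measurePreserving_eval (fun e => gaussianReal 0 (v e)) e
    have h2 : ∀ᵐ t ∂(gaussianReal 0 (v e)), t = 0 := by
      rw [hv e he, gaussianReal_zero_var]
      simp [ae_dirac_eq]
    filter_upwards [h.quasiMeasurePreserving.ae h2] with x hx _ using hx
  · simp [he]

lemma correlation_eq_zero {f : (ι → ℝ) → ℝ} (hf : Measurable f) {S : Set ι}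
    (hS : ∀ x, f (flipSigns S x) = -f x) {v : ι → ℝ≥0} (hv : ∀ e ∈ S, v e = 0) (w : ι → ℝ≥0) :
    correlation f v w = 0 := by
  unfold correlation
  rw [← integral_zero (ι → ℝ) ℝ (μ := gaussianVector v)]
  refine integral_congr_ae ?_
  filter_upwards [ae_gaussianVector_eq_zero hv] with x hx
  simp [heat_eq_zero hf hS w hx]

lemma correlation_le_one {f : (ι → ℝ) → ℝ} (h1 : ∀ x, |f x| ≤ 1) (v w : ι → ℝ≥0) :
    correlation f v w ≤ 1 := by
  refine (le_abs_self _).trans (abs_integral_le_of_bound fun x => ?_)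
  simpa using abs_sq_le (abs_heat_le w h1 x)

/-- A convex sequence that starts at `0` lies below its chords. -/
lemma convex_seq_le {b : ℕ → ℝ} {n : ℕ} (h0 : b 0 = 0)
    (hb : ∀ k, k + 2 ≤ n → 2 * b (k + 1) ≤ b k + b (k + 2)) :
    ∀ k, k + 1 ≤ n → ((k : ℝ) + 1) * b k ≤ k * b (k + 1) := by
  intro k
  induction k with
  | zero => intro _; simp [h0]
  | succ k ih =>
    intro hk
    have h1 := ih (by omega)
    have h2 := hb k (by omega)
    have h3 := mul_le_mul_of_nonneg_left h2 (by positivity : (0 : ℝ) ≤ k + 1)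
    push_cast
    linarith

open Classical in
/-- Variances of the common part: `1` on `T` and `N / (N + 1)` elsewhere. -/
def keptVar {ι : Type*} (N : ℕ) (T : Set ι) : ι → ℝ≥0 :=
  fun e => if e ∈ T then 1 else (N : ℝ≥0) / (N + 1)

open Classical in
/-- Variances of the resampled part: `0` on `T` and `1 / (N + 1)` elsewhere. -/
def freshVar {ι : Type*} (N : ℕ) (T : Set ι) : ι → ℝ≥0 :=
  fun e => if e ∈ T then 0 else 1 / ((N : ℝ≥0) + 1)

/-- Increase the shared part of the noise on `S` from nothing to everything: the correlation is
convex along the way and starts at `0` by oddness, so it lies below its chord. -/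
lemma correlation_le_of_odd {f : (ι → ℝ) → ℝ} (hf : Measurable f) {C : ℝ}
    (hC : ∀ x, |f x| ≤ C) {S T : Set ι} (hST : Disjoint S T)
    (hS : ∀ x, f (flipSigns S x) = -f x) (N : ℕ) :
    correlation f (keptVar N T) (freshVar N T)
      ≤ (N : ℝ) / (N + 1) * correlation f (keptVar N (T ∪ S)) (freshVar N (T ∪ S)) := by
  classical
  set h : ι → ℝ≥0 := fun e => if e ∈ S then 1 / ((N : ℝ≥0) + 1) else 0 with hh
  set v : ι → ℝ≥0 := fun e => if e ∈ S then 0 else keptVar N T e with hv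
  set w : ι → ℝ≥0 := fun e => if e ∈ S then 0 else freshVar N T e with hw
  -- The noise on `S` is cut into `N + 1` layers of variance `1/(N+1)`, of which `k` are shared. The
  -- case of interest is `k = N`; at `k = N + 1` the block is fully shared.
  set b : ℕ → ℝ := fun k => correlation f (v + k • h) ((N + 1 - k) • h + w) with hb
  have hN : (N : ℝ≥0) + 1 ≠ 0 := by positivity
  have b0 : b 0 = 0 := correlation_eq_zero hf hS (by
    intro e he
    simp [hv, he]) _
  have hconv : ∀ k, k + 2 ≤ N + 1 → 2 * b (k + 1) ≤ b k + b (k + 2) := by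
    intro k hk
    have := two_mul_correlation_le hf hC (v + k • h) ((N + 1 - (k + 2)) • h + w) h
    have e1 : v + k • h + h = v + (k + 1) • h := by rw [add_assoc, succ_nsmul]
    have e2 : v + (k + 1) • h + h = v + (k + 2) • h := by
      rw [add_assoc, ← succ_nsmul]
    have e3 : h + ((N + 1 - (k + 2)) • h + w) = (N + 1 - (k + 1)) • h + w := by
      rw [show N + 1 - (k + 1) = (N + 1 - (k + 2)) + 1 by omega, succ_nsmul']; abel
    have e4 : h + ((N + 1 - (k + 1)) • h + w) = (N + 1 - k) • h + w := by
      rw [show N + 1 - k = (N + 1 - (k + 1)) + 1 by omega, succ_nsmul']; abel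
    rw [e3, e4, e1, e2] at this
    simp only [hb]
    linarith
  have key := convex_seq_le b0 hconv N le_rfl
  have eN : b N = correlation f (keptVar N T) (freshVar N T) := by
    simp only [hb]
    congr 1
    · funext e
      by_cases he : e ∈ S
      · have : e ∉ T := Set.disjoint_left.1 hST he
        simp [hv, hh, he, keptVar, this, div_eq_mul_inv]
      · simp [hv, hh, he]
    · funext e
      by_cases he : e ∈ S
      · have : e ∉ T := Set.disjoint_left.1 hST he
        simp [hw, hh, he, freshVar, this]
      · simp [hw, hh, he]
  have eN1 : b (N + 1) = correlation f (keptVar N (T ∪ S)) (freshVar N (T ∪ S)) := by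
    simp only [hb]
    congr 1
    · funext e
      by_cases he : e ∈ S
      · simp [hv, hh, he, keptVar, hN]
      · simp [hv, hh, he, keptVar]
    · funext e
      by_cases he : e ∈ S
      · simp [hw, hh, he, freshVar]
      · simp [hw, hh, he, freshVar]
  rw [← eN, ← eN1, div_mul_eq_mul_div, le_div_iff₀ (by positivity)]
  linarith

/-- A bounded function of a Gaussian vector that is odd in each of `m` disjoint blocks of
coordinates decorrelates at the rate `(1 - s) ^ m` when a proportion `s = 1 / (N + 1)` of the
noise is resampled. -/
theorem correlation_le_pow {f : (ι → ℝ) → ℝ} (hf : Measurable f) (h1 : ∀ x, |f x| ≤ 1)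
    {E : ℕ → Set ι} {m : ℕ} (hE : ∀ j < m, ∀ k < j, Disjoint (E j) (E k))
    (hodd : ∀ k < m, ∀ x, f (flipSigns (E k) x) = -f x) (N : ℕ) :
    correlation f (keptVar N ∅) (freshVar N ∅) ≤ ((N : ℝ) / (N + 1)) ^ m := by
  -- The blocks are switched to full sharing one at a time. Disjointness ensures that a new block is
  -- still only partially shared when its turn comes.
  have key : ∀ k ≤ m, correlation f (keptVar N ∅) (freshVar N ∅)
      ≤ ((N : ℝ) / (N + 1)) ^ k *
        correlation f (keptVar N (⋃ j < k, E j)) (freshVar N (⋃ j < k, E j)) := by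
    intro k
    induction k with
    | zero => intro _; simp
    | succ k ih =>
      intro hk
      refine (ih (by omega)).trans ?_
      rw [pow_succ, mul_assoc]
      refine mul_le_mul_of_nonneg_left ?_ (by positivity)
      have hd : Disjoint (E k) (⋃ j < k, E j) := by
        simp only [Set.disjoint_iUnion_right]
        exact fun j hj => hE k (by omega) j hj
      rw [Set.biUnion_lt_succ]
      exact correlation_le_of_odd hf h1 hd (hodd k (by omega)) N
  refine (key m le_rfl).trans ?_
  exact mul_le_of_le_one_right (by positivity) (correlation_le_one h1 _ _)

end Gaussian

/-! ### Hyperplanes are null sets. -/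

section Hyperplane

variable {ι : Type*} [Fintype ι]

/-- A hyperplane is null for the standard Gaussian vector. -/
lemma ae_sum_mul_ne_zero (c : ι → ℝ) {e : ι} (he : c e ≠ 0) :
    ∀ᵐ x ∂gaussianVector (1 : ι → ℝ≥0), ∑ i, x i * c i ≠ 0 := by
  classical
  -- Split off the coordinate `e`, on which the linear form is nontrivial: given all the others, a
  -- nondegenerate Gaussian variable must hit a single value.
  set w : ι → ℝ≥0 := Pi.single e 1 with hw
  set v : ι → ℝ≥0 := fun i => if i = e then 0 else 1 with hv
  have hvw : (1 : ι → ℝ≥0) = v + w := by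
    funext i
    by_cases h : i = e
    · subst h; simp [hv, hw]
    · simp [hv, hw, h]
  have hms : MeasurableSet {x : ι → ℝ | ∑ i, x i * c i = 0} :=
    measurableSet_eq_fun (by fun_prop) (by fun_prop)
  have hw0 : ∀ᵐ y ∂gaussianVector w, ∀ i ∈ ({e}ᶜ : Set ι), y i = 0 :=
    ae_gaussianVector_eq_zero fun i hi => by
      simp only [Set.mem_compl_iff, Set.mem_singleton_iff] at hi
      simp [hw, hi]
  have hwe : ∀ t : ℝ, ∀ᵐ y ∂gaussianVector w, y e ≠ t := by
    intro t
    have h := measurePreserving_eval (fun i => gaussianReal 0 (w i)) e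
    have h2 : ∀ᵐ s ∂(gaussianReal 0 (w e)), s ≠ t := by
      have : NullSingletonClass (gaussianReal 0 (w e)) :=
        nullSingletonClass_gaussianReal (by simp [hw])
      rw [ae_iff]; simp
    exact h.quasiMeasurePreserving.ae h2
  rw [ae_iff, hvw]
  simp only [ne_eq, not_not]
  rw [← map_add_gaussianVector, Measure.map_apply (by fun_prop) hms,
    Measure.measure_prod_null ((by fun_prop : Measurable
      fun p : (ι → ℝ) × (ι → ℝ) => p.1 + p.2) hms)]
  refine Filter.Eventually.of_forall fun x => ?_
  have : ∀ᵐ y ∂gaussianVector w, ¬ (∑ i, (x + y) i * c i = 0) := by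
    filter_upwards [hw0, hwe (-(∑ i, x i * c i) / c e)] with y hy0 hye h
    apply hye
    have h1 : ∑ i, y i * c i = y e * c e := by
      refine Finset.sum_eq_single e (fun i _ hi => ?_) (by simp)
      rw [hy0 i hi, zero_mul]
    simp only [Pi.add_apply, add_mul, Finset.sum_add_distrib, h1] at h
    rw [eq_div_iff he]
    linarith
  rw [ae_iff] at this
  simpa using this

end Hyperplane

/-! ### Gauge symmetry, uniqueness of the ground state, and cheap regions from small overlaps. -/

section Spins

variable {V : Type*}

lemma bond_mk (σ : V → ℤˣ) (x y : V) : bond σ s(x, y) = ((σ x : ℤ) : ℝ) * ((σ y : ℤ) : ℝ) := by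
  simp [bond, Sym2.map_mk, Sym2.mul_mk]

lemma abs_bond (σ : V → ℤˣ) (e : Sym2 V) : |bond σ e| = 1 := by
  unfold bond
  rcases Int.units_eq_one_or (e.map σ).mul with h | h <;> simp [h]

lemma units_mul_swap : ∀ {a b c d : ℤˣ}, a * b = c * d → a * c = b * d := by decide

lemma overturn_overturn (A : Set V) (σ : V → ℤˣ) : overturn A (overturn A σ) = σ := by
  funext x
  by_cases h : x ∈ A <;> simp [overturn, h]

lemma overturn_eq (σ τ : V → ℤˣ) : overturn {x | σ x ≠ τ x} σ = τ := by
  funext x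
  by_cases h : σ x = τ x
  · simp [overturn, h]
  · simp only [overturn, Set.mem_ofPred_eq, ne_eq, h, not_false_eq_true, if_true]
    rcases Int.units_eq_one_or (σ x) with h1 | h1 <;>
      rcases Int.units_eq_one_or (τ x) with h2 | h2 <;> simp_all

lemma mem_edgeBoundary_iff (G : SimpleGraph V) (A : Set V) {x y : V} (h : G.Adj x y) :
    s(x, y) ∈ edgeBoundary G A ↔ ¬ (x ∈ A ↔ y ∈ A) := by
  constructor
  · rintro ⟨-, a, ha, b, hb, hab⟩
    rcases Sym2.eq_iff.1 hab with ⟨rfl, rfl⟩ | ⟨rfl, rfl⟩ <;> tauto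
  · intro hn
    refine ⟨h, ?_⟩
    by_cases hx : x ∈ A
    · exact ⟨x, hx, y, by tauto, rfl⟩
    · exact ⟨y, by tauto, x, hx, Sym2.eq_swap⟩

lemma bond_overturn_of_mem {G : SimpleGraph V} {A : Set V} (σ : V → ℤˣ) {e : Sym2 V}
    (he : e ∈ edgeBoundary G A) : bond (overturn A σ) e = -bond σ e := by
  obtain ⟨-, x, hx, y, hy, rfl⟩ := he
  simp [bond_mk, overturn, hx, hy]

lemma bond_overturn_of_notMem {G : SimpleGraph V} {A : Set V} (σ : V → ℤˣ) {e : Sym2 V}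
    (he : e ∈ G.edgeSet) (hA : e ∉ edgeBoundary G A) : bond (overturn A σ) e = bond σ e := by
  induction e with
  | _ x y =>
    rw [mem_edgeBoundary_iff G A he, not_not] at hA
    by_cases hx : x ∈ A
    · simp [bond_mk, overturn, hx, hA.1 hx]
    · have hy : y ∉ A := fun h => hx (hA.2 h)
      simp [bond_mk, overturn, hx, hy]

variable [Fintype V] (G : SimpleGraph V)

/-- The edges of `∂A`, as a set of indices of the disorder. -/
def boundaryIndices (A : Set V) : Set G.edgeSet := {e | e.1 ∈ edgeBoundary G A}

lemma hamiltonian_eq [Fintype G.edgeSet] (J : G.edgeSet → ℝ) (σ : V → ℤˣ) :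
    hamiltonian G J σ = -∑ e : G.edgeSet, J e * bond σ e := by
  unfold hamiltonian
  congr!

/-- Gauge symmetry: exactly the bonds across the cut change sign, and so do their couplings. -/
lemma hamiltonian_flipSigns_overturn (A : Set V) (J : G.edgeSet → ℝ) (σ : V → ℤˣ) :
    hamiltonian G (flipSigns (boundaryIndices G A) J) (overturn A σ) = hamiltonian G J σ := by
  classical
  rw [hamiltonian_eq, hamiltonian_eq]
  congr 1
  refine Finset.sum_congr rfl fun e _ => ?_
  by_cases h : e.1 ∈ edgeBoundary G A
  · simp [flipSigns, boundaryIndices, h, bond_overturn_of_mem σ h]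
  · simp [flipSigns, boundaryIndices, h, bond_overturn_of_notMem σ e.2 h]

lemma flipSigns_flipSigns {ι : Type*} (S : Set ι) (x : ι → ℝ) :
    flipSigns S (flipSigns S x) = x := by
  funext e
  by_cases h : e ∈ S <;> simp [flipSigns, h]

/-- As `A` avoids `B`, the gauge transformation is an involution of the configurations satisfying
the boundary condition, and it preserves energies. -/
lemma isGroundState_flipSigns {B A : Set V} (hA : A ⊆ Bᶜ) {γ : B → ℤˣ} {J : G.edgeSet → ℝ}
    {σ : V → ℤˣ} (h : IsGroundState G B γ J σ) :
    IsGroundState G B γ (flipSigns (boundaryIndices G A) J) (overturn A σ) := by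
  have hx : ∀ x : B, (x : V) ∉ A := fun x hx => hA hx x.2
  refine ⟨fun x => by simp [overturn, hx x, h.1 x], fun τ hτ => ?_⟩
  have := h.2 (overturn A τ) fun x => by simp [overturn, hx x, hτ x]
  rw [hamiltonian_flipSigns_overturn, ← overturn_overturn A τ, hamiltonian_flipSigns_overturn]
  exact this

lemma exists_isGroundState (B : Set V) (γ : B → ℤˣ) (J : G.edgeSet → ℝ) :
    ∃ σ, IsGroundState G B γ J σ := by
  classical
  have hne : (Set.univ.toFinset.filter fun σ : V → ℤˣ => ∀ x : B, σ x = γ x).Nonempty :=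
    ⟨fun x => if h : x ∈ B then γ ⟨x, h⟩ else 1, by
      simp +contextual⟩
  obtain ⟨σ, hσ, hmin⟩ := Finset.exists_min_image _ (hamiltonian G J) hne
  exact ⟨σ, by simpa using hσ, fun τ hτ => hmin τ (by simpa using hτ)⟩

lemma measurable_hamiltonian (σ : V → ℤˣ) : Measurable fun J => hamiltonian G J σ := by
  unfold hamiltonian
  fun_prop

lemma measurableSet_isGroundState (B : Set V) (γ : B → ℤˣ) (σ : V → ℤˣ) :
    MeasurableSet {J | IsGroundState G B γ J σ} := by
  have : {J | IsGroundState G B γ J σ} = {J | (∀ x : B, σ x = γ x) ∧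
    ∀ τ : V → ℤˣ, (∀ x : B, τ x = γ x) → hamiltonian G J σ ≤ hamiltonian G J τ} := rfl
  rw [this]
  refine measurableSet_setOfPred.2 (measurable_const.and (Measurable.forall fun τ => ?_))
  exact measurable_const.imp (measurableSet_setOfPred.1
    (measurableSet_le (measurable_hamiltonian G σ) (measurable_hamiltonian G τ)))

open Classical in
/-- The product of the spins at `i` and `j` in the ground state, if all ground states agree on it,
and `0` otherwise. -/
def pairSpin (B : Set V) (γ : B → ℤˣ) (i j : V) (J : G.edgeSet → ℝ) : ℝ :=
  (if ∀ σ, IsGroundState G B γ J σ → σ i * σ j = 1 then 1 else 0)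
    - (if ∀ σ, IsGroundState G B γ J σ → σ i * σ j = -1 then 1 else 0)

lemma abs_pairSpin_le (B : Set V) (γ : B → ℤˣ) (i j : V) (J : G.edgeSet → ℝ) :
    |pairSpin G B γ i j J| ≤ 1 := by
  unfold pairSpin
  split_ifs <;> simp

lemma measurable_pairSpin (B : Set V) (γ : B → ℤˣ) (i j : V) :
    Measurable (pairSpin G B γ i j) := by
  have h : ∀ a : ℤˣ, MeasurableSet
      {J : G.edgeSet → ℝ | ∀ σ, IsGroundState G B γ J σ → σ i * σ j = a} := fun a =>
    measurableSet_setOfPred.2 (Measurable.forall fun σ =>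
      (measurableSet_setOfPred.1 (measurableSet_isGroundState G B γ σ)).imp measurable_const)
  exact (Measurable.ite (h 1) measurable_const measurable_const).sub
    (Measurable.ite (h (-1)) measurable_const measurable_const)

/-- Overturning `A` changes the spin at `i` but not at `j`. Since `pairSpin` quantifies over all
ground states and vanishes in case of disagreement, oddness holds for every `J`, not merely almost
surely. -/
lemma pairSpin_flipSigns {B A : Set V} (hA : A ⊆ Bᶜ) (γ : B → ℤˣ) {i j : V} (hi : i ∈ A)
    (hj : j ∉ A) (J : G.edgeSet → ℝ) :
    pairSpin G B γ i j (flipSigns (boundaryIndices G A) J) = -pairSpin G B γ i j J := by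
  have key : ∀ a : ℤˣ, ∀ J : G.edgeSet → ℝ,
      (∀ σ, IsGroundState G B γ J σ → σ i * σ j = a) →
      ∀ σ, IsGroundState G B γ (flipSigns (boundaryIndices G A) J) σ → σ i * σ j = -a := by
    intro a J h σ hσ
    have := h _ (flipSigns_flipSigns (boundaryIndices G A) J ▸ isGroundState_flipSigns G hA hσ)
    rw [← this]
    simp [overturn, hi, hj]
  have key2 : ∀ a : ℤˣ,
      (∀ σ, IsGroundState G B γ (flipSigns (boundaryIndices G A) J) σ → σ i * σ j = -a) ↔
      (∀ σ, IsGroundState G B γ J σ → σ i * σ j = a) := by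
    refine fun a => ⟨fun h => ?_, key a J⟩
    have := key (-a) _ h
    rwa [flipSigns_flipSigns, neg_neg] at this
  have h1 := key2 (-1)
  rw [neg_neg] at h1
  have h2 := key2 1
  unfold pairSpin
  classical
  rw [if_congr h1 rfl rfl, if_congr h2 rfl rfl, neg_sub]

/-- Decorrelation of the ground states under resampling of a small part of the noise. -/
lemma correlation_pairSpin_le [Fintype G.edgeSet] {B : Set V} (γ : B → ℤˣ) {i j : V}
    {ρ : V → ℕ} (hρ : ∀ x y, G.Adj x y → ρ y ≤ ρ x + 1) (hi : ρ i = 0) {m : ℕ} (hj : m ≤ ρ j)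
    (hB : ∀ x ∈ B, m ≤ ρ x) (N : ℕ) :
    correlation (pairSpin G B γ i j) (keptVar N ∅) (freshVar N ∅)
      ≤ ((N : ℝ) / (N + 1)) ^ m := by
  refine correlation_le_pow (measurable_pairSpin G B γ i j) (abs_pairSpin_le G B γ i j)
    -- For `k < m` the sublevel set of `ρ` at `k` contains `i` and misses `j` and `B`. An edge of
    -- its cut joins the levels `k` and `k + 1`, so different cuts are disjoint.
    (E := fun k => boundaryIndices G {x | ρ x ≤ k}) (fun a ha b hb => ?_) (fun k hk J => ?_) N
  · rw [Set.disjoint_left]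
    rintro e ⟨-, x, hx, y, hy, h1⟩ ⟨-, x', hx', y', hy', h2⟩
    have hadj : G.Adj x y := by have := e.2; rwa [h1] at this
    have hl := hρ x y hadj
    have hl' := hρ y x hadj.symm
    simp only [Set.mem_ofPred_eq] at hx hy hx' hy'
    rw [h1] at h2
    rcases Sym2.eq_iff.1 h2 with ⟨rfl, rfl⟩ | ⟨rfl, rfl⟩ <;> omega
  · refine pairSpin_flipSigns G (fun x hx hxB => ?_) γ (by simp [hi]) (by simp; omega) J
    have := hB x hxB
    simp only [Set.mem_ofPred_eq] at hx
    omega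

/-- Almost surely, all ground states have the same satisfied edges. -/
lemma ae_bond_eq [Fintype G.edgeSet] (B : Set V) (γ : B → ℤˣ) :
    ∀ᵐ J ∂gaussianVector (1 : G.edgeSet → ℝ≥0), ∀ σ τ, IsGroundState G B γ J σ →
      IsGroundState G B γ J τ → ∀ e : G.edgeSet, bond σ e = bond τ e := by
  rw [ae_all_iff]; intro σ
  rw [ae_all_iff]; intro τ
  by_cases h : ∀ e : G.edgeSet, bond σ e = bond τ e
  · exact Filter.Eventually.of_forall fun _ _ _ => h
  · push Not at h
    obtain ⟨e, he⟩ := h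
    -- Configurations with different bonds have equal energies only when `J` lies on a hyperplane.
    filter_upwards [ae_sum_mul_ne_zero (fun e : G.edgeSet => bond σ e - bond τ e)
      (sub_ne_zero.2 he)] with J hJ h1 h2
    exfalso
    apply hJ
    have := le_antisymm (h1.2 τ h2.1) (h2.2 σ h1.1)
    rw [hamiltonian_eq, hamiltonian_eq] at this
    simp only [mul_sub, Finset.sum_sub_distrib]
    linarith

/-- Equal bonds make the product of two ground states constant along edges. Connectedness, in the
form `hG`, makes it constant everywhere, so the two agree up to a global sign, which pair products
do not see. -/
lemma ae_pairSpin_eq [Fintype G.edgeSet]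
    (hG : ∀ g : V → ℤˣ, (∀ x y, G.Adj x y → g x = g y) → ∀ x y, g x = g y)
    (B : Set V) (γ : B → ℤˣ) :
    ∀ᵐ J ∂gaussianVector (1 : G.edgeSet → ℝ≥0), ∀ σ, IsGroundState G B γ J σ →
      ∀ i j, pairSpin G B γ i j J = ((σ i : ℤ) : ℝ) * ((σ j : ℤ) : ℝ) := by
  filter_upwards [ae_bond_eq G B γ] with J hJ σ hσ i j
  have hall : ∀ τ, IsGroundState G B γ J τ → τ i * τ j = σ i * σ j := by
    intro τ hτ
    have hc := hG (fun x => σ x * τ x) (fun x y hxy => by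
      have := hJ σ τ hσ hτ ⟨s(x, y), hxy⟩
      simp only [bond_mk] at this
      have h2 : σ x * σ y = τ x * τ y := by
        apply Units.ext
        push_cast
        exact_mod_cast this
      exact units_mul_swap h2) i j
    exact (units_mul_swap hc).symm
  have hiff : ∀ a : ℤˣ, (∀ τ, IsGroundState G B γ J τ → τ i * τ j = a) ↔ σ i * σ j = a :=
    fun a => ⟨fun h => h σ hσ, fun h τ hτ => (hall τ hτ).trans h⟩
  unfold pairSpin
  simp only [hiff]
  rcases Int.units_eq_one_or (σ i) with a | a <;>
    rcases Int.units_eq_one_or (σ j) with b | b <;> simp [a, b]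

lemma energyCost_add (J J' : G.edgeSet → ℝ) (σ : V → ℤˣ) (A : Set V) :
    energyCost G (J + J') σ A = energyCost G J σ A + energyCost G J' σ A := by
  classical
  simp only [energyCost, hamiltonian_eq, Pi.add_apply, add_mul, Finset.sum_add_distrib]
  ring

lemma energyCost_le {J : G.edgeSet → ℝ} {M : ℝ} (hJ : ∀ e, |J e| ≤ M) (σ : V → ℤˣ) (A : Set V) :
    energyCost G J σ A ≤ 2 * M * (edgeBoundary G A).ncard := by
  classical
  have hcard : (edgeBoundary G A).ncard
      = (Finset.univ.filter fun e : G.edgeSet => e.1 ∈ edgeBoundary G A).card := by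
    rw [← Set.ncard_coe_finset, ← Set.ncard_image_of_injective _ Subtype.val_injective]
    congr 1
    ext e
    simp only [Finset.coe_filter, Finset.mem_univ, true_and, Set.mem_image, Set.mem_ofPred_eq,
      Subtype.exists, exists_and_left, exists_prop, exists_eq_right_right]
    exact ⟨fun h => ⟨h, h.1⟩, fun h => h.1⟩
  have h1 : energyCost G J σ A
      = ∑ e : G.edgeSet, if e.1 ∈ edgeBoundary G A then 2 * (J e * bond σ e) else 0 := by
    rw [energyCost, hamiltonian_eq, hamiltonian_eq, sub_neg_eq_add, neg_add_eq_sub,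
      ← Finset.sum_sub_distrib]
    refine Finset.sum_congr rfl fun e _ => ?_
    split_ifs with h
    · rw [bond_overturn_of_mem σ h]; ring
    · rw [bond_overturn_of_notMem σ e.2 h]; ring
  rw [h1, ← Finset.sum_filter, hcard]
  refine (Finset.sum_le_card_nsmul _ _ (2 * M) fun e _ => ?_).trans_eq ?_
  · have := le_abs_self (J e * bond σ e)
    rw [abs_mul, abs_bond, mul_one] at this
    linarith [hJ e]
  · rw [nsmul_eq_mul, mul_comm]

/-- Positivity of `t` excludes an empty family of regions, for which the real `sInf` is `0`. -/
lemma le_minCostRatio_iff {B : Set V} {J : G.edgeSet → ℝ} {σ : V → ℤˣ} {t : ℝ} (ht : 0 < t) :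
    t ≤ minCostRatio G B J σ ↔ (macroscopicRegions B).Nonempty ∧
      ∀ A ∈ macroscopicRegions B, t ≤ energyCost G J σ A / ((edgeBoundary G A).ncard : ℝ) := by
  constructor
  · intro h
    refine ⟨?_, fun A hA => h.trans (csInf_le (Set.toFinite _).bddBelow ⟨A, hA, rfl⟩)⟩
    by_contra hne
    rw [Set.not_nonempty_iff_eq_empty] at hne
    simp [minCostRatio, hne] at h
    linarith
  · rintro ⟨hne, h⟩
    refine le_csInf (hne.image _) ?_
    rintro _ ⟨A, hA, rfl⟩
    exact h A hA

lemma le_of_le_minCostRatio {B : Set V} {J : G.edgeSet → ℝ} {σ : V → ℤˣ} {t M : ℝ} (ht : 0 < t)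
    (hF : t ≤ minCostRatio G B J σ) {A : Set V} (hA : A ∈ macroscopicRegions B)
    (hc : energyCost G J σ A ≤ 2 * M * (edgeBoundary G A).ncard) : t ≤ 2 * M := by
  have h1 : t ≤ energyCost G J σ A / ((edgeBoundary G A).ncard : ℝ) :=
    ((le_minCostRatio_iff G ht).1 hF).2 A hA
  rcases Nat.eq_zero_or_pos (edgeBoundary G A).ncard with h0 | h0
  -- With an empty edge boundary the ratio is `0`, contradicting `0 < t`.
  · rw [h0] at h1; simp at h1; linarith
  · exact h1.trans ((div_le_iff₀ (by exact_mod_cast h0)).2 hc)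

lemma measurable_energyCost (σ : V → ℤˣ) (A : Set V) : Measurable fun J => energyCost G J σ A :=
  (measurable_hamiltonian G _).sub (measurable_hamiltonian G _)

lemma measurableSet_le_minCostRatio (B : Set V) (σ : V → ℤˣ) {t : ℝ} (ht : 0 < t) :
    MeasurableSet {J | t ≤ minCostRatio G B J σ} := by
  simp only [le_minCostRatio_iff G ht]
  refine measurableSet_setOfPred.2 (measurable_const.and (Measurable.forall fun A => ?_))
  exact measurable_const.imp (measurableSet_setOfPred.1
    (measurableSet_le measurable_const ((measurable_energyCost G σ A).div_const _)))

omit [Fintype V] in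
lemma sum_mul_eq_card_sub (W : Finset V) (σ τ : V → ℤˣ) (hW : ∀ x ∉ W, σ x = τ x) :
    ∑ x ∈ W, ((σ x : ℤ) : ℝ) * ((τ x : ℤ) : ℝ)
      = W.card - 2 * ({x | σ x ≠ τ x} : Set V).ncard := by
  classical
  have hs : ({x | σ x ≠ τ x} : Set V) = ↑(W.filter fun x => σ x ≠ τ x) := by
    ext x
    simp only [Set.mem_ofPred_eq, Finset.coe_filter]
    exact ⟨fun h => ⟨by_contra fun hx => h (hW x hx), h⟩, fun h => h.2⟩
  rw [hs, Set.ncard_coe_finset, Finset.card_filter, Finset.card_eq_sum_ones]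
  push_cast
  rw [Finset.mul_sum, ← Finset.sum_sub_distrib]
  refine Finset.sum_congr rfl fun x _ => ?_
  rcases Int.units_eq_one_or (σ x) with h1 | h1 <;>
    rcases Int.units_eq_one_or (τ x) with h2 | h2 <;> simp [h1, h2] <;> norm_num

/-- If the ground states in the environments `J` and `J'` have a small overlap, then the region on
which they differ is macroscopic and cheap. -/
lemma le_of_overlap_le {B : Set V} {γ : B → ℤˣ} {W : Finset V} (hW : (W : Set V) = Bᶜ)
    {J J' : G.edgeSet → ℝ} {σ τ : V → ℤˣ} (hσ : IsGroundState G B γ J σ)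
    (hτ : IsGroundState G B γ J' τ) {t M : ℝ} (ht : 0 < t) (hF : t ≤ minCostRatio G B J σ)
    (hM : ∀ e, |J e - J' e| ≤ M)
    (hR : (∑ x ∈ W, ((σ x : ℤ) : ℝ) * ((τ x : ℤ) : ℝ)) ^ 2 ≤ (W.card : ℝ) ^ 2 / 4) :
    t ≤ 2 * M := by
  have hWm : ∀ x, x ∉ W ↔ x ∈ B := fun x => by
    rw [← Finset.mem_coe, hW, Set.notMem_compl_iff]
  have heq : ∀ x ∉ W, σ x = τ x := fun x hx => by
    have hx := (hWm x).1 hx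
    rw [hσ.1 ⟨x, hx⟩, hτ.1 ⟨x, hx⟩]
  rw [sum_mul_eq_card_sub W σ τ heq] at hR
  set A : Set V := {x | σ x ≠ τ x} with hA
  have hn : Bᶜ.ncard = W.card := by rw [← hW, Set.ncard_coe_finset]
  -- With `n = |V°|`, the inequality `|n - 2|A|| ≤ n/2` is exactly `n/4 ≤ |A| ≤ 3n/4`.
  have habs : |(W.card : ℝ) - 2 * A.ncard| ≤ W.card / 2 := by
    apply abs_le_of_sq_le_sq _ (by positivity)
    linarith [hR, show ((W.card : ℝ) / 2) ^ 2 = (W.card : ℝ) ^ 2 / 4 by ring]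
  rw [abs_le] at habs
  have hAm : A ∈ macroscopicRegions B := by
    refine ⟨fun x hx => ?_, ?_, ?_⟩
    · rw [← hW]
      exact by_contra fun h => hx (heq x h)
    · rw [hn]; linarith
    · rw [hn]; linarith
  refine le_of_le_minCostRatio G ht hF hAm ?_
  have h1 : energyCost G J σ A = energyCost G (J - J') σ A + energyCost G J' σ A := by
    rw [← energyCost_add, sub_add_cancel]
  have h2 : energyCost G J' σ A ≤ 0 := by
    rw [energyCost, overturn_eq]
    linarith [hτ.2 σ hσ.1]
  have h3 := energyCost_le G (J := J - J') (M := M) hM σ A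
  linarith

end Spins

/-! ### Gaussian tails and union bounds. -/

section Tail

lemma measureReal_mono_of_ae {α : Type*} [MeasurableSpace α] {μ : Measure α} [IsFiniteMeasure μ]
    {S T : Set α} (h : ∀ᵐ x ∂μ, x ∈ S → x ∈ T) : μ.real S ≤ μ.real T :=
  ENNReal.toReal_mono (measure_ne_top _ _) (measure_mono_ae h)

lemma gaussianReal_abs_ge_le (c : ℝ≥0) {s : ℝ} (hs : 0 ≤ s) :
    (gaussianReal 0 c).real {x | s ≤ |x|} ≤ 2 * Real.exp (-s ^ 2 / (2 * c)) := by
  have h : HasSubgaussianMGF (fun x : ℝ => x) c (gaussianReal 0 c) :=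
    ⟨fun t => integrable_exp_mul_gaussianReal t, fun t => by
      rw [mgf_fun_id_gaussianReal]; simp⟩
  have h1 := h.measure_ge_le hs
  have h2 := h.neg.measure_ge_le hs
  have hu : {x : ℝ | s ≤ |x|} = {x | s ≤ x} ∪ {x | s ≤ (-fun x : ℝ => x) x} := by
    ext x
    simp [le_abs]
  rw [hu, two_mul]
  exact (measureReal_union_le _ _).trans (add_le_add h1 h2)

lemma gaussianVector_exists_abs_ge_le {ι : Type*} [Fintype ι] {w : ι → ℝ≥0} {c : ℝ≥0}
    (hw : ∀ e, w e = c) {s : ℝ} (hs : 0 ≤ s) :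
    (gaussianVector w).real {y | ∃ e, s ≤ |y e|}
      ≤ 2 * Fintype.card ι * Real.exp (-s ^ 2 / (2 * c)) := by
  have hu : {y : ι → ℝ | ∃ e, s ≤ |y e|} = ⋃ e, (fun y => y e) ⁻¹' {x | s ≤ |x|} := by
    ext y; simp
  rw [hu]
  refine (measureReal_iUnion_fintype_le _).trans ?_
  have h : ∀ e : ι, (gaussianVector w).real ((fun y => y e) ⁻¹' {x | s ≤ |x|})
      ≤ 2 * Real.exp (-s ^ 2 / (2 * c)) := by
    intro e
    have hp := measurePreserving_eval (fun e => gaussianReal 0 (w e)) e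
    have hm : MeasurableSet {x : ℝ | s ≤ |x|} := measurableSet_le (by fun_prop) (by fun_prop)
    have := hp.measureReal_preimage hm.nullMeasurableSet
    rw [hw e] at this
    exact (le_of_eq this).trans (gaussianReal_abs_ge_le c hs)
  refine (Finset.sum_le_sum fun e _ => h e).trans_eq ?_
  simp only [Finset.sum_const, Finset.card_univ, nsmul_eq_mul]
  ring

end Tail

/-! ### Probability of a large `F` in terms of the overlap. -/

section Bounds

variable {V : Type*} [Fintype V] (G : SimpleGraph V) [Fintype G.edgeSet]

/-- The environments in which some ground state satisfies `t ≤ F`. -/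
def costlyEnvironments (B : Set V) (γ : B → ℤˣ) (t : ℝ) : Set (G.edgeSet → ℝ) :=
  {J | ∃ σ, IsGroundState G B γ J σ ∧ t ≤ minCostRatio G B J σ}

omit [Fintype G.edgeSet] in
lemma measurableSet_costlyEnvironments (B : Set V) (γ : B → ℤˣ) {t : ℝ} (ht : 0 < t) :
    MeasurableSet (costlyEnvironments G B γ t) := by
  refine measurableSet_setOfPred.2 (Measurable.exists fun σ => Measurable.and ?_ ?_)
  · exact measurableSet_setOfPred.1 (measurableSet_isGroundState G B γ σ)
  · exact measurableSet_setOfPred.1 (measurableSet_le_minCostRatio G B σ ht)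

/-- The choice of `σ` need not be measurable in `ω`, so it is traded for the existence of some
costly ground state, an event depending on `J` alone, whose law is the standard Gaussian vector. -/
lemma IsRandomGroundState.real_le {Ω : Type*} [MeasurableSpace Ω] {P : Measure Ω}
    [IsProbabilityMeasure P] {B : Set V} {γ : B → ℤˣ} {J : Ω → G.edgeSet → ℝ}
    {σ : Ω → V → ℤˣ} (h : IsRandomGroundState P G B γ J σ) {t : ℝ} :
    P.real {ω | t ≤ minCostRatio G B (J ω) (σ ω)}
      ≤ (gaussianVector (1 : G.edgeSet → ℝ≥0)).real (costlyEnvironments G B γ t) := by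
  have hm : ∀ e, AEMeasurable (fun ω => J ω e) P := fun e => (h.hasLaw e).aemeasurable
  have hJ : AEMeasurable J P := aemeasurable_pi_lambda _ hm
  have hmap : P.map J = gaussianVector 1 := by
    have := (iIndepFun_iff_map_fun_eq_pi_map hm).1 h.indep
    simp only [(h.hasLaw _).map_eq] at this
    exact this
  refine (measureReal_mono_of_ae (T := J ⁻¹' costlyEnvironments G B γ t) ?_).trans ?_
  · filter_upwards [h.ground] with ω hω ht
    exact ⟨σ ω, hω, ht⟩
  · rw [← hmap]
    refine ENNReal.toReal_mono ?_ (Measure.le_map_apply hJ _)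
    rw [hmap]
    exact measure_ne_top _ _

/-- Testing any macroscopic region gives `F ≤ 2 max|J|`; if all couplings were below `t/4`, this
would yield `t ≤ t/2`. -/
lemma costlyEnvironments_real_le (B : Set V) (γ : B → ℤˣ) {t : ℝ} (ht : 0 < t) :
    (gaussianVector (1 : G.edgeSet → ℝ≥0)).real (costlyEnvironments G B γ t)
      ≤ 2 * Fintype.card G.edgeSet * Real.exp (-(t / 4) ^ 2 / 2) := by
  have h := gaussianVector_exists_abs_ge_le (w := (1 : G.edgeSet → ℝ≥0)) (c := 1)
    (fun e => rfl) (s := t / 4) (by positivity)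
  rw [NNReal.coe_one, mul_one] at h
  refine (measureReal_mono ?_).trans h
  rintro J ⟨σ, -, hF⟩
  by_contra hn
  simp only [Set.mem_ofPred_eq, not_exists, not_le] at hn
  obtain ⟨A, hA⟩ := ((le_minCostRatio_iff G ht).1 hF).1
  have := le_of_le_minCostRatio G ht hF hA (energyCost_le G (M := t / 4) (fun e => (hn e).le) σ A)
  linarith

lemma keptVar_add_freshVar {ι : Type*} (N : ℕ) : keptVar N ∅ + freshVar N ∅ = (1 : ι → ℝ≥0) := by
  funext e
  have : (N : ℝ≥0) + 1 ≠ 0 := by positivity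
  simp only [Pi.add_apply, keptVar, freshVar, Set.mem_empty_iff_false, if_false, Pi.one_apply]
  rw [← add_div, div_self this]

lemma integral_mul_eq_correlation {ι : Type*} [Fintype ι] {f : (ι → ℝ) → ℝ} (hf : Measurable f)
    (h1 : ∀ x, |f x| ≤ 1) (v w : ι → ℝ≥0) :
    Integrable (fun p : (ι → ℝ) × (ι → ℝ) × (ι → ℝ) => f (p.1 + p.2.1) * f (p.1 + p.2.2))
      ((gaussianVector v).prod ((gaussianVector w).prod (gaussianVector w))) ∧
    ∫ p, f (p.1 + p.2.1) * f (p.1 + p.2.2)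
      ∂((gaussianVector v).prod ((gaussianVector w).prod (gaussianVector w)))
      = correlation f v w := by
  have hm : Measurable
      fun p : (ι → ℝ) × (ι → ℝ) × (ι → ℝ) => f (p.1 + p.2.1) * f (p.1 + p.2.2) :=
    (hf.comp (by fun_prop)).mul (hf.comp (by fun_prop))
  have hi : Integrable
      (fun p : (ι → ℝ) × (ι → ℝ) × (ι → ℝ) => f (p.1 + p.2.1) * f (p.1 + p.2.2))
      ((gaussianVector v).prod ((gaussianVector w).prod (gaussianVector w))) :=
    integrable_of_bound (C := 1) hm fun p => by
      rw [abs_mul]; exact mul_le_one₀ (h1 _) (abs_nonneg _) (h1 _)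
  refine ⟨hi, ?_⟩
  rw [integral_prod _ hi]
  unfold correlation
  congr 1
  funext x
  rw [sq]
  exact integral_prod_mul (fun y => f (x + y)) (fun y => f (x + y))

/-- The probability of costly environments, in terms of the decorrelation of the ground state. -/
theorem costlyEnvironments_real_le_correlation {B : Set V} (γ : B → ℤˣ) {W : Finset V}
    (hW : (W : Set V) = Bᶜ) (hW0 : W.Nonempty)
    (hG : ∀ g : V → ℤˣ, (∀ x y, G.Adj x y → g x = g y) → ∀ x y, g x = g y)
    {t : ℝ} (ht : 0 < t) (N : ℕ) :
    (gaussianVector (1 : G.edgeSet → ℝ≥0)).real (costlyEnvironments G B γ t)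
      ≤ 4 * ((∑ i ∈ W, ∑ j ∈ W, correlation (pairSpin G B γ i j) (keptVar N ∅) (freshVar N ∅))
          / (W.card : ℝ) ^ 2)
        + 2 * (2 * Fintype.card G.edgeSet * Real.exp (-(t / 8) ^ 2 * (N + 1) / 2)) := by
  set v : G.edgeSet → ℝ≥0 := keptVar N ∅ with hv
  set w : G.edgeSet → ℝ≥0 := freshVar N ∅ with hw
  have hvw : v + w = 1 := keptVar_add_freshVar N
  set μ := (gaussianVector v).prod ((gaussianVector w).prod (gaussianVector w)) with hμ
  have hp1 : MeasurePreserving (fun p : (G.edgeSet → ℝ) × (G.edgeSet → ℝ) × (G.edgeSet → ℝ) =>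
      p.1 + p.2.1) μ (gaussianVector 1) := by
    rw [← hvw]
    exact (measurePreserving_add_gaussianVector v w).comp
      ((MeasurePreserving.id _).prod measurePreserving_fst)
  have hp2 : MeasurePreserving (fun p : (G.edgeSet → ℝ) × (G.edgeSet → ℝ) × (G.edgeSet → ℝ) =>
      p.1 + p.2.2) μ (gaussianVector 1) := by
    rw [← hvw]
    exact (measurePreserving_add_gaussianVector v w).comp
      ((MeasurePreserving.id _).prod measurePreserving_snd)
  have hq1 : MeasurePreserving (fun p : (G.edgeSet → ℝ) × (G.edgeSet → ℝ) × (G.edgeSet → ℝ) =>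
      p.2.1) μ (gaussianVector w) := measurePreserving_fst.comp measurePreserving_snd
  have hq2 : MeasurePreserving (fun p : (G.edgeSet → ℝ) × (G.edgeSet → ℝ) × (G.edgeSet → ℝ) =>
      p.2.2) μ (gaussianVector w) := measurePreserving_snd.comp measurePreserving_snd
  set Φ : (G.edgeSet → ℝ) × (G.edgeSet → ℝ) × (G.edgeSet → ℝ) → ℝ := fun p =>
    ∑ i ∈ W, ∑ j ∈ W, pairSpin G B γ i j (p.1 + p.2.1) * pairSpin G B γ i j (p.1 + p.2.2) with hΦ
  -- Almost surely `Φ` is the squared overlap; this also supplies the nonnegativity that Markov's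
  -- inequality requires.
  have hsq : ∀ᵐ p ∂μ, ∀ σ τ, IsGroundState G B γ (p.1 + p.2.1) σ →
      IsGroundState G B γ (p.1 + p.2.2) τ →
      Φ p = (∑ x ∈ W, ((σ x : ℤ) : ℝ) * ((τ x : ℤ) : ℝ)) ^ 2 := by
    have hu := ae_pairSpin_eq G hG B γ
    filter_upwards [hp1.quasiMeasurePreserving.ae hu, hp2.quasiMeasurePreserving.ae hu]
      with p h1 h2 σ τ hσ hτ
    rw [sq, Finset.sum_mul_sum]
    refine Finset.sum_congr rfl fun i _ => Finset.sum_congr rfl fun j _ => ?_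
    rw [h1 σ hσ, h2 τ hτ]
    ring
  have hint := fun i j => integral_mul_eq_correlation (measurable_pairSpin G B γ i j)
    (abs_pairSpin_le G B γ i j) v w
  have hΦi : Integrable Φ μ :=
    integrable_finsetSum _ fun i _ => integrable_finsetSum _ fun j _ => (hint i j).1
  have hΦe : ∫ p, Φ p ∂μ = ∑ i ∈ W, ∑ j ∈ W, correlation (pairSpin G B γ i j) v w := by
    rw [integral_finsetSum _ fun i _ => integrable_finsetSum _ fun j _ => (hint i j).1]
    refine Finset.sum_congr rfl fun i _ => ?_
    rw [integral_finsetSum _ fun j _ => (hint i j).1]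
    exact Finset.sum_congr rfl fun j _ => (hint i j).2
  have hΦ0 : 0 ≤ᵐ[μ] Φ := by
    filter_upwards [hsq] with p hp
    obtain ⟨σ, hσ⟩ := exists_isGroundState G B γ (p.1 + p.2.1)
    obtain ⟨τ, hτ⟩ := exists_isGroundState G B γ (p.1 + p.2.2)
    rw [hp σ τ hσ hτ]
    exact sq_nonneg _
  have hc : (0 : ℝ) < (W.card : ℝ) ^ 2 / 4 := by
    have : (0 : ℝ) < W.card := by exact_mod_cast hW0.card_pos
    positivity
  have hmarkov := mul_meas_ge_le_integral_of_nonneg hΦ0 hΦi ((W.card : ℝ) ^ 2 / 4)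
  have hfirst : μ.real {p | (W.card : ℝ) ^ 2 / 4 ≤ Φ p}
      ≤ 4 * ((∑ i ∈ W, ∑ j ∈ W, correlation (pairSpin G B γ i j) v w) / (W.card : ℝ) ^ 2) := by
    rw [← hΦe]
    rw [mul_comm, ← le_div_iff₀ hc] at hmarkov
    refine hmarkov.trans_eq ?_
    rw [div_div_eq_mul_div]
    ring
  have htail := gaussianVector_exists_abs_ge_le (w := w) (c := 1 / ((N : ℝ≥0) + 1))
    (fun e => by simp [hw, freshVar]) (s := t / 8) (by positivity)
  have hexp : -(t / 8) ^ 2 / (2 * ((1 / ((N : ℝ≥0) + 1) : ℝ≥0) : ℝ))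
      = -(t / 8) ^ 2 * (N + 1) / 2 := by
    push_cast
    field_simp
  rw [hexp] at htail
  have hTm : MeasurableSet {y : G.edgeSet → ℝ | ∃ e, t / 8 ≤ |y e|} := by
    refine measurableSet_setOfPred.2 (Measurable.exists fun e => ?_)
    exact measurableSet_setOfPred.1 (measurableSet_le (by fun_prop) (by fun_prop))
  have ht1 := hq1.measureReal_preimage hTm.nullMeasurableSet
  have ht2 := hq2.measureReal_preimage hTm.nullMeasurableSet
  rw [← hp1.measureReal_preimage (measurableSet_costlyEnvironments G B γ ht).nullMeasurableSet]
  -- Outside these three events the overlap is small and all fresh couplings are below `t/8`. Then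
  -- `|J - J'| ≤ t/4` on every edge, and the small overlap would force `t ≤ t/2`.
  refine (measureReal_mono_of_ae (T := {p | (W.card : ℝ) ^ 2 / 4 ≤ Φ p} ∪
    ((fun p => p.2.1) ⁻¹' {y : G.edgeSet → ℝ | ∃ e, t / 8 ≤ |y e|} ∪
      (fun p => p.2.2) ⁻¹' {y : G.edgeSet → ℝ | ∃ e, t / 8 ≤ |y e|})) ?_).trans ?_
  · filter_upwards [hsq] with p hp ⟨σ, hσ, hF⟩
    by_contra hn
    simp only [Set.mem_union, Set.mem_preimage, Set.mem_ofPred_eq, not_or, not_exists,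
      not_le] at hn
    obtain ⟨hn1, hn2, hn3⟩ := hn
    obtain ⟨τ, hτ⟩ := exists_isGroundState G B γ (p.1 + p.2.2)
    rw [hp σ τ hσ hτ] at hn1
    have := le_of_overlap_le G hW hσ hτ ht hF (M := t / 4) (fun e => ?_) hn1.le
    · linarith
    · have h2 := abs_sub (p.2.1 e) (p.2.2 e)
      have h3 := hn2 e
      have h4 := hn3 e
      simp only [Pi.add_apply, add_sub_add_left_eq_sub]
      linarith
  · refine (measureReal_union_le _ _).trans (add_le_add hfirst ?_)
    refine (measureReal_union_le _ _).trans ?_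
    rw [ht1, ht2]
    linarith

end Bounds

/-! ### Choice of the resampled proportion. -/

section Scaling

lemma card_edgeSet_le {V : Type*} [Fintype V] (G : SimpleGraph V) [Fintype G.edgeSet] {d L : ℕ}
    (hL : 2 ≤ L) (hV : Fintype.card V ≤ (L + 1) ^ d) :
    (Fintype.card G.edgeSet : ℝ) ≤ Real.exp (4 * d * Real.log L) := by
  have h1 : Fintype.card G.edgeSet ≤ Fintype.card V ^ 2 := by
    rw [← SimpleGraph.edgeFinset_card]
    exact G.card_edgeFinset_le_card_choose_two.trans (Nat.choose_le_pow _ _)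
  have h2 : Fintype.card G.edgeSet ≤ L ^ (4 * d) := by
    calc Fintype.card G.edgeSet ≤ ((L + 1) ^ d) ^ 2 := h1.trans (Nat.pow_le_pow_left hV 2)
      _ ≤ ((L ^ 2) ^ d) ^ 2 := by gcongr; nlinarith
      _ = L ^ (4 * d) := by rw [← pow_mul, ← pow_mul]; congr 1; ring
  have hL0 : (0 : ℝ) < L := by positivity
  calc (Fintype.card G.edgeSet : ℝ) ≤ (L : ℝ) ^ (4 * d) := by exact_mod_cast h2
    _ = Real.exp (4 * d * Real.log L) := by
      rw [← Real.exp_log (pow_pos hL0 (4 * d)), Real.log_pow]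
      push_cast; rfl

lemma threshold_sq {L K : ℝ} (hL : 1 ≤ L) :
    (8 * K * L ^ (-(1 / 2) : ℝ) * √(Real.log L)) ^ 2 = 64 * (K ^ 2 / L * Real.log L) := by
  have h1 : (L ^ (-(1 / 2) : ℝ)) ^ 2 = L⁻¹ := by
    rw [← Real.rpow_natCast, ← Real.rpow_mul (by linarith)]
    norm_num
    exact Real.rpow_neg_one L
  rw [mul_pow, mul_pow, mul_pow, h1, Real.sq_sqrt (Real.log_nonneg hL)]
  field_simp
  ring

lemma pow_mul_exp_neg_le {u : ℝ} (hu : 0 ≤ u) (d : ℕ) :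
    u ^ d * Real.exp (-(u * Real.log 2)) ≤ d.factorial / Real.log 2 ^ d := by
  have hl : 0 < Real.log 2 := Real.log_pos one_lt_two
  have h := Real.pow_div_factorial_le_exp (u * Real.log 2) (by positivity) d
  rw [Real.exp_neg, ← div_eq_mul_inv, div_le_div_iff₀ (Real.exp_pos _) (by positivity)]
  rw [div_le_iff₀ (by positivity), mul_pow] at h
  linarith

/-- The tail bound for `F` that follows from a power law decay of the overlap. -/
theorem costlyEnvironments_real_le_of_overlap {V : Type*} [Fintype V] (G : SimpleGraph V)
    [Fintype G.edgeSet] {B : Set V} (γ : B → ℤˣ) {W : Finset V}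
    (hW : (W : Set V) = Bᶜ) (hW0 : W.Nonempty)
    (hG : ∀ g : V → ℤˣ, (∀ x y, G.Adj x y → g x = g y) → ∀ x y, g x = g y)
    {d p L : ℕ} (hd : 1 ≤ d) (hpd : p ≤ d) (hL : 2 ≤ L)
    (hV : Fintype.card V ≤ (L + 1) ^ d) {a : ℝ} (ha : 0 ≤ a)
    (hcorr : ∀ N : ℕ,
      (∑ i ∈ W, ∑ j ∈ W, correlation (pairSpin G B γ i j) (keptVar N ∅) (freshVar N ∅))
        / (W.card : ℝ) ^ 2 ≤ a * (((N : ℝ) + 1) / L) ^ p) {K : ℝ} (hK : 0 < K) :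
    (gaussianVector (1 : G.edgeSet → ℝ≥0)).real
        (costlyEnvironments G B γ (8 * K * (L : ℝ) ^ (-(1 / 2) : ℝ) * √(Real.log L)))
      ≤ (4 * a * (24 * d) ^ p + 4 * (12 * d) ^ p + 2 * (d.factorial / Real.log 2 ^ d))
        / (K ^ 2) ^ p := by
  set t := 8 * K * (L : ℝ) ^ (-(1 / 2) : ℝ) * √(Real.log L) with ht
  have hL2 : (2 : ℝ) ≤ L := by exact_mod_cast hL
  have hL0 : (0 : ℝ) < L := by linarith
  have hd1 : (1 : ℝ) ≤ d := by exact_mod_cast hd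
  have hl2 : 0 < Real.log 2 := Real.log_pos one_lt_two
  have hl : Real.log 2 ≤ Real.log L := Real.log_le_log two_pos hL2
  have hl0 : 0 < Real.log L := hl2.trans_le hl
  have ht0 : 0 < t := by positivity
  have htsq : t ^ 2 = 64 * (K ^ 2 / L * Real.log L) := threshold_sq (by linarith)
  have hE := card_edgeSet_le G hL hV
  have hKp : 0 < (K ^ 2) ^ p := by positivity
  have hLp : (L : ℝ) ^ p = Real.exp (p * Real.log L) := by
    rw [← Real.exp_log (pow_pos hL0 p), Real.log_pow]
  have hpd' : (p : ℝ) ≤ d := by exact_mod_cast hpd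
  have hA : 0 ≤ 4 * a * (24 * d) ^ p := by positivity
  have hB : 0 ≤ 4 * (12 * (d : ℝ)) ^ p := by positivity
  have hD : 0 ≤ 2 * (d.factorial / Real.log 2 ^ d) := by positivity
  rcases le_total (K ^ 2) (12 * d * L) with hcase | hcase
  -- Taking `N + 1 = ⌈r⌉` brings the Gaussian factor down to `L^(-6d)`, which beats the at most
  -- `L^(4d)` edges; since `r ≥ 1`, rounding up costs at most a factor `2`.
  · set r := 12 * d * L / K ^ 2 with hr
    have hr1 : 1 ≤ r := (one_le_div (by positivity)).2 hcase
    obtain ⟨N, hN⟩ : ∃ N : ℕ, ⌈r⌉₊ = N + 1 :=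
      Nat.exists_eq_succ_of_ne_zero (Nat.ceil_pos.2 (by linarith)).ne'
    have hN1 : r ≤ (N : ℝ) + 1 := by
      have := Nat.le_ceil r; rw [hN] at this; exact_mod_cast this
    have hN2 : (N : ℝ) + 1 ≤ 2 * r := by
      have := Nat.ceil_lt_add_one (a := r) (by linarith)
      rw [hN] at this; push_cast at this; linarith
    refine (costlyEnvironments_real_le_correlation G γ hW hW0 hG ht0 N).trans ?_
    have h1 : a * (((N : ℝ) + 1) / L) ^ p ≤ a * (24 * d) ^ p / (K ^ 2) ^ p := by
      rw [mul_div_assoc, ← div_pow]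
      refine mul_le_mul_of_nonneg_left (pow_le_pow_left₀ (by positivity) ?_ p) ha
      rw [div_le_iff₀ hL0]
      refine hN2.trans_eq ?_
      rw [hr]; field_simp; norm_num
    have h2 : Fintype.card G.edgeSet * Real.exp (-(t / 8) ^ 2 * (N + 1) / 2)
        ≤ (12 * d) ^ p / (K ^ 2) ^ p := by
      have e1 : -(t / 8) ^ 2 * (N + 1) / 2 ≤ -(6 * d * Real.log L) := by
        have : (t / 8) ^ 2 = K ^ 2 / L * Real.log L := by rw [div_pow, htsq]; ring
        rw [this]
        have h3 : K ^ 2 / L * r = 12 * d := by rw [hr]; field_simp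
        have h4 : K ^ 2 / L * r ≤ K ^ 2 / L * (N + 1) :=
          mul_le_mul_of_nonneg_left hN1 (by positivity)
        have h5 := mul_le_mul_of_nonneg_right (h3 ▸ h4) hl0.le
        linarith
      calc Fintype.card G.edgeSet * Real.exp (-(t / 8) ^ 2 * (N + 1) / 2)
          ≤ Real.exp (4 * d * Real.log L) * Real.exp (-(6 * d * Real.log L)) :=
            mul_le_mul hE (Real.exp_le_exp.2 e1) (Real.exp_pos _).le (Real.exp_pos _).le
        _ = Real.exp (-(2 * d * Real.log L)) := by rw [← Real.exp_add]; congr 1; ring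
        _ ≤ Real.exp (-(p * Real.log L)) := by
            apply Real.exp_le_exp.2
            have := mul_le_mul_of_nonneg_right (show (p : ℝ) ≤ 2 * d by linarith) hl0.le
            linarith
        _ = 1 / (L : ℝ) ^ p := by rw [hLp, Real.exp_neg, one_div]
        _ ≤ (12 * d) ^ p / (K ^ 2) ^ p := by
            rw [div_le_div_iff₀ (by positivity) hKp, one_mul, ← mul_pow]
            exact pow_le_pow_left₀ (by positivity) hcase p
    have h3 := (hcorr N).trans h1
    calc _ ≤ 4 * (a * (24 * d) ^ p / (K ^ 2) ^ p) + 4 * ((12 * d) ^ p / (K ^ 2) ^ p) := by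
          linarith
      _ ≤ _ := by
          rw [add_div, add_div]
          have : 0 ≤ 2 * (d.factorial / Real.log 2 ^ d) / (K ^ 2) ^ p := by positivity
          refine le_trans (le_of_eq ?_) (le_add_of_nonneg_right this)
          ring
  · refine (costlyEnvironments_real_le G B γ ht0).trans ?_
    set u := K ^ 2 / L with hu
    have hu12 : 12 * d ≤ u := (le_div_iff₀ hL0).2 hcase
    have hu1 : 1 ≤ u := by linarith
    have hKu : (K ^ 2) ^ p = u ^ p * (L : ℝ) ^ p := by
      rw [← mul_pow, hu, div_mul_cancel₀ _ hL0.ne']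
    have e1 : -(t / 4) ^ 2 / 2 = -(2 * u * Real.log L) := by
      rw [div_pow, htsq]; ring
    rw [le_div_iff₀ hKp, e1]
    calc 2 * Fintype.card G.edgeSet * Real.exp (-(2 * u * Real.log L)) * (K ^ 2) ^ p
        ≤ 2 * Real.exp (4 * d * Real.log L) * Real.exp (-(2 * u * Real.log L)) * (K ^ 2) ^ p := by
          gcongr
      _ = 2 * (u ^ p * Real.exp ((4 * d + p - 2 * u) * Real.log L)) := by
          rw [hKu, hLp, show (4 * d + p - 2 * u) * Real.log L
            = 4 * d * Real.log L + -(2 * u * Real.log L) + p * Real.log L by ring,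
            Real.exp_add, Real.exp_add]
          ring
      -- From `u ≥ 12d` and `p ≤ d` one gets `4d + p - 2u ≤ -u`, and `log L ≥ log 2` removes `L`
      -- from the bound.
      _ ≤ 2 * (u ^ d * Real.exp (-(u * Real.log 2))) := by
          have h1 : u ^ p ≤ u ^ d := pow_le_pow_right₀ hu1 hpd
          have h2 : (4 * d + p - 2 * u) * Real.log L ≤ -(u * Real.log 2) := by
            have h3 := mul_le_mul_of_nonneg_right
              (show 4 * d + p - 2 * u ≤ -u by linarith) hl0.le
            have h4 := mul_le_mul_of_nonneg_left hl (show 0 ≤ u by linarith)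
            linarith
          gcongr
      _ ≤ 2 * (d.factorial / Real.log 2 ^ d) := by
          gcongr
          exact pow_mul_exp_neg_le (by linarith) d
      _ ≤ _ := by linarith

end Scaling

/-! ### Distances, connectedness and geometric sums on the cube and the torus. -/

section Lattice

lemma sum_geometric_le (N : ℕ) (T : Finset ℕ) :
    ∑ k ∈ T, ((N : ℝ) / (N + 1)) ^ k ≤ (N : ℝ) + 1 := by
  have h1 : (N : ℝ) / (N + 1) < 1 := by rw [div_lt_one (by positivity)]; linarith
  have h0 : (0 : ℝ) ≤ (N : ℝ) / (N + 1) := by positivity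
  refine ((summable_geometric_of_lt_one h0 h1).sum_le_tsum T
    (fun k _ => by positivity)).trans_eq ?_
  rw [tsum_geometric_of_lt_one h0 h1]
  have : (N : ℝ) + 1 ≠ 0 := by positivity
  field_simp
  ring

/-- By injectivity each absolute value occurs at most once per sign, so two geometric series
suffice. -/
lemma sum_pow_natAbs_le {α : Type*} (N : ℕ) (s : Finset α) {k : α → ℤ}
    (hk : Function.Injective k) :
    ∑ a ∈ s, ((N : ℝ) / (N + 1)) ^ (k a).natAbs ≤ 2 * ((N : ℝ) + 1) := by
  classical
  have key : ∀ t : Finset α, Set.InjOn (fun a => (k a).natAbs) t →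
      ∑ a ∈ t, ((N : ℝ) / (N + 1)) ^ (k a).natAbs ≤ (N : ℝ) + 1 := by
    intro t ht
    rw [← Finset.sum_image (f := fun m => ((N : ℝ) / (N + 1)) ^ m) ht]
    exact sum_geometric_le N _
  rw [← Finset.sum_filter_add_sum_filter_not s (fun a => 0 ≤ k a), two_mul]
  refine add_le_add (key _ ?_) (key _ ?_)
  · intro a ha b hb hab
    simp only [Finset.coe_filter, Set.mem_ofPred_eq] at ha hb
    exact hk (by simp only at hab; omega)
  · intro a ha b hb hab
    simp only [Finset.coe_filter, Set.mem_ofPred_eq] at ha hb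
    exact hk (by simp only at hab; omega)

lemma eq_of_update_invariant {d : ℕ} {α β : Type*} (g : (Fin d → α) → β)
    (h : ∀ x i a, g x = g (Function.update x i a)) (x y : Fin d → α) : g x = g y := by
  have key : ∀ s : Finset (Fin d), g x = g (s.piecewise y x) := by
    intro s
    induction s using Finset.induction_on with
    | empty => simp
    | insert i s _ ih => rw [Finset.piecewise_insert, ← h, ih]
  simpa using key Finset.univ

/-- The `ℓ¹` distance attached to a distance `δ` on the factors. -/
def sumDist {d : ℕ} {α : Type*} (δ : α → α → ℕ) (x y : Fin d → α) : ℕ :=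
  ∑ c, δ (x c) (y c)

lemma sumDist_le_add_one {d : ℕ} {α : Type*} {δ : α → α → ℕ} {z x y : Fin d → α} {c : Fin d}
    (hc : δ (z c) (y c) ≤ δ (z c) (x c) + 1) (h : ∀ j ≠ c, y j = x j) :
    sumDist δ z y ≤ sumDist δ z x + 1 := by
  unfold sumDist
  rw [← Finset.add_sum_erase _ _ (Finset.mem_univ c),
    ← Finset.add_sum_erase (a := c) _ (fun c => δ (z c) (x c)) (Finset.mem_univ c)]
  have : ∑ j ∈ Finset.univ.erase c, δ (z j) (y j) = ∑ j ∈ Finset.univ.erase c, δ (z j) (x j) :=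
    Finset.sum_congr rfl fun j hj => by rw [h j (Finset.ne_of_mem_erase hj)]
  rw [this]
  omega

/-- The distance is additive over coordinates, so the sum factorizes into `d` one-dimensional sums.
-/
lemma sum_pow_sumDist_le {d : ℕ} {α : Type*} [Fintype α] {δ : α → α → ℕ} {b : ℝ} {N : ℕ}
    (hδ : ∀ a, ∑ a', ((N : ℝ) / (N + 1)) ^ δ a a' ≤ b) (x : Fin d → α) :
    ∑ y, ((N : ℝ) / (N + 1)) ^ sumDist δ x y ≤ b ^ d := by
  simp only [sumDist, ← Finset.prod_pow_eq_pow_sum]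
  have := Finset.prod_univ_sum (fun _ : Fin d => (Finset.univ : Finset α))
    (fun c a => ((N : ℝ) / (N + 1)) ^ δ (x c) a)
  rw [Fintype.piFinset_univ] at this
  rw [← this]
  refine (Finset.prod_le_prod (fun c _ => Finset.sum_nonneg fun a _ => by positivity)
    (fun c _ => hδ (x c))).trans_eq ?_
  simp

/-- The decay of the overlap without boundary. -/
lemma overlap_le_of_sumDist {d L : ℕ} {α : Type*} [Fintype α] (hL : 0 < L)
    (hα : L ≤ Fintype.card α) (G : SimpleGraph (Fin d → α)) [Fintype G.edgeSet]
    {B : Set (Fin d → α)} (hB : B = ∅) (γ : B → ℤˣ) {δ : α → α → ℕ} (hδ0 : ∀ a, δ a a = 0)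
    (hδ : ∀ z x y, G.Adj x y → sumDist δ z y ≤ sumDist δ z x + 1) {N : ℕ}
    (hs : ∀ a, ∑ a', ((N : ℝ) / (N + 1)) ^ δ a a' ≤ 2 * ((N : ℝ) + 1)) :
    (∑ i ∈ Finset.univ, ∑ j ∈ Finset.univ,
      correlation (pairSpin G B γ i j) (keptVar N ∅) (freshVar N ∅))
        / ((Finset.univ : Finset (Fin d → α)).card : ℝ) ^ 2
      ≤ 2 ^ d * (((N : ℝ) + 1) / L) ^ d := by
  have hL0 : (0 : ℝ) < L := by exact_mod_cast hL
  have hcard : (L : ℝ) ^ d ≤ (Finset.univ : Finset (Fin d → α)).card := by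
    rw [Finset.card_univ, Fintype.card_fun, Fintype.card_fin]
    exact_mod_cast Nat.pow_le_pow_left hα d
  set n : ℝ := ((Finset.univ : Finset (Fin d → α)).card : ℝ) with hn
  have hn0 : 0 < n := lt_of_lt_of_le (by positivity) hcard
  have h1 : ∀ i : Fin d → α, ∑ j ∈ Finset.univ,
      correlation (pairSpin G B γ i j) (keptVar N ∅) (freshVar N ∅)
        ≤ (2 * ((N : ℝ) + 1)) ^ d := by
    intro i
    refine le_trans (Finset.sum_le_sum fun j _ => ?_) (sum_pow_sumDist_le hs i)
    -- Without boundary the balls around `i` may grow until they reach `j`, so the exponent is the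
    -- full distance.
    refine correlation_pairSpin_le G γ (ρ := sumDist δ i) (fun x y => hδ i x y) ?_ le_rfl ?_ N
    · simp [sumDist, hδ0]
    · simp [hB]
  have h2 := Finset.sum_le_card_nsmul Finset.univ _ _ fun i _ => h1 i
  rw [nsmul_eq_mul, ← hn] at h2
  calc _ ≤ n * (2 * ((N : ℝ) + 1)) ^ d / n ^ 2 := by gcongr
    _ = (2 * ((N : ℝ) + 1)) ^ d / n := by field_simp
    _ ≤ (2 * ((N : ℝ) + 1)) ^ d / (L : ℝ) ^ d := by gcongr
    _ = _ := by rw [← mul_pow, ← div_pow, mul_div_assoc]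

/-- The distance on `{0, …, L}`. -/
def pathDist {L : ℕ} (a b : Fin (L + 1)) : ℕ := ((b : ℤ) - (a : ℤ)).natAbs

lemma cube_adj {d L : ℕ} {x y : Fin d → Fin (L + 1)} (h : (cube d L).Adj x y) :
    ∃ i, ((y i : ℕ) = (x i : ℕ) + 1 ∨ (x i : ℕ) = (y i : ℕ) + 1) ∧ ∀ j ≠ i, y j = x j := by
  rw [cube, SimpleGraph.fromRel_adj] at h
  rcases h.2 with ⟨i, h1, h2⟩ | ⟨i, h1, h2⟩
  · exact ⟨i, Or.inl h1, h2⟩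
  · exact ⟨i, Or.inr h1, fun j hj => (h2 j hj).symm⟩

lemma cube_sumDist {d L : ℕ} (z x y : Fin d → Fin (L + 1)) (h : (cube d L).Adj x y) :
    sumDist pathDist z y ≤ sumDist pathDist z x + 1 := by
  obtain ⟨i, h1, h2⟩ := cube_adj h
  exact sumDist_le_add_one (c := i) (by unfold pathDist; omega) h2

lemma cube_connected (d L : ℕ) {β : Type*} (g : (Fin d → Fin (L + 1)) → β)
    (hg : ∀ x y, (cube d L).Adj x y → g x = g y) (x y : Fin d → Fin (L + 1)) : g x = g y := by
  refine eq_of_update_invariant g (fun x i a => ?_) x y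
  have key : ∀ a, g (Function.update x i a) = g (Function.update x i 0) := by
    intro a
    induction a using Fin.induction with
    | zero => rfl
    | succ k ih =>
      rw [← ih]
      symm
      apply hg
      rw [cube, SimpleGraph.fromRel_adj]
      refine ⟨fun he => ?_, Or.inl ⟨i, by simp, fun j hj => by simp [hj]⟩⟩
      have := congrFun he i
      simp only [Function.update_self] at this
      exact (Fin.castSucc_lt_succ).ne this
  rw [key a, ← key (x i), Function.update_eq_self]

lemma pathDist_sum_le {L : ℕ} (N : ℕ) (s : Finset (Fin (L + 1))) (a : Fin (L + 1)) :
    ∑ a' ∈ s, ((N : ℝ) / (N + 1)) ^ pathDist a a' ≤ 2 * ((N : ℝ) + 1) :=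
  sum_pow_natAbs_le N s (k := fun b : Fin (L + 1) => (b : ℤ) - (a : ℤ)) fun b c h => by
    simp only at h
    exact Fin.ext (by omega)

/-- The distance on `ℤ/L`. -/
def cycleDist {L : ℕ} (a b : ZMod L) : ℕ := (b - a).valMinAbs.natAbs

lemma cycleDist_sum_le {L : ℕ} [NeZero L] (N : ℕ) (a : ZMod L) :
    ∑ a', ((N : ℝ) / (N + 1)) ^ cycleDist a a' ≤ 2 * ((N : ℝ) + 1) :=
  sum_pow_natAbs_le N _ (k := fun b : ZMod L => (b - a).valMinAbs) fun _ _ h =>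
    sub_left_injective (ZMod.injective_valMinAbs h)

lemma natAbs_valMinAbs_one_le (L : ℕ) [NeZero L] : (1 : ZMod L).valMinAbs.natAbs ≤ 1 := by
  rw [ZMod.valMinAbs_natAbs_eq_min]
  exact (min_le_left _ _).trans (by
    rw [ZMod.val_one_eq_one_mod]; exact Nat.mod_le _ _)

lemma natAbs_valMinAbs_add_le' {L : ℕ} [NeZero L] (a b : ZMod L) :
    (a + b).valMinAbs.natAbs ≤ a.valMinAbs.natAbs + b.valMinAbs.natAbs :=
  (ZMod.natAbs_valMinAbs_add_le a b).trans (Int.natAbs_add_le _ _)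

lemma torus_sumDist {d L : ℕ} [NeZero L] (z x y : Fin d → ZMod L) (h : (torus d L).Adj x y) :
    sumDist cycleDist z y ≤ sumDist cycleDist z x + 1 := by
  have h1 := natAbs_valMinAbs_one_le L
  rw [torus, SimpleGraph.fromRel_adj] at h
  rcases h.2 with ⟨i, hi, hj⟩ | ⟨i, hi, hj⟩
  · refine sumDist_le_add_one (c := i) ?_ hj
    unfold cycleDist
    rw [hi, add_sub_right_comm]
    exact (natAbs_valMinAbs_add_le' _ _).trans (by omega)
  · refine sumDist_le_add_one (c := i) ?_ fun j hji => (hj j hji).symm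
    unfold cycleDist
    rw [hi, show y i - z i = (y i + 1 - z i) + -1 by ring]
    refine (natAbs_valMinAbs_add_le' _ _).trans ?_
    rw [ZMod.natAbs_valMinAbs_neg]
    omega

lemma torus_connected (d L : ℕ) [NeZero L] {β : Type*} (g : (Fin d → ZMod L) → β)
    (hg : ∀ x y, (torus d L).Adj x y → g x = g y) (x y : Fin d → ZMod L) : g x = g y := by
  refine eq_of_update_invariant g (fun x i a => ?_) x y
  have step : ∀ a, g (Function.update x i a) = g (Function.update x i (a + 1)) := by
    intro a
    -- When `L = 1` the two points coincide and no edge joins them.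
    by_cases he : Function.update x i a = Function.update x i (a + 1)
    · rw [he]
    · apply hg
      rw [torus, SimpleGraph.fromRel_adj]
      exact ⟨he, Or.inl ⟨i, by simp, fun j hj => by simp [hj]⟩⟩
  have key : ∀ n : ℕ, g (Function.update x i (n : ZMod L)) = g (Function.update x i 0) := by
    intro n
    induction n with
    | zero => simp
    | succ n ih => rw [← ih, step n]; push_cast; rfl
  have key' : ∀ a : ZMod L, g (Function.update x i a) = g (Function.update x i 0) := fun a => by
    have := key a.val
    rwa [ZMod.natCast_zmod_val] at this
  rw [key' a, ← key' (x i), Function.update_eq_self]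

/-- The interior `{1, …, L - 1}` of `{0, …, L}`. -/
def pathInterior (L : ℕ) : Finset (Fin (L + 1)) :=
  Finset.univ.filter fun a => 0 < (a : ℕ) ∧ (a : ℕ) < L

lemma card_pathInterior (L : ℕ) : (pathInterior L).card = L - 1 := by
  rw [← Finset.card_image_of_injective _ Fin.val_injective]
  have : (pathInterior L).image Fin.val = Finset.Ioo 0 L := by
    ext k
    simp only [pathInterior, Finset.mem_image, Finset.mem_filter, Finset.mem_univ, true_and,
      Finset.mem_Ioo]
    exact ⟨by rintro ⟨a, ha, rfl⟩; exact ha, fun h => ⟨⟨k, by omega⟩, h, rfl⟩⟩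
  rw [this, Nat.card_Ioo]
  omega

lemma coe_piFinset_pathInterior (d L : ℕ) :
    ((Fintype.piFinset fun _ : Fin d => pathInterior L : Finset (Fin d → Fin (L + 1))) :
      Set (Fin d → Fin (L + 1))) = (cubeBoundary d L)ᶜ := by
  ext x
  simp only [Finset.mem_coe, Fintype.mem_piFinset, pathInterior, Finset.mem_filter,
    Finset.mem_univ, true_and, cubeBoundary, Set.mem_compl_iff, Set.mem_ofPred_eq, not_exists]
  refine forall_congr' fun i => ?_
  have := (x i).isLt
  omega

/-- The distance to the boundary of `{0, …, L}`. -/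
def pathDepth {L : ℕ} (a : Fin (L + 1)) : ℕ := min (a : ℕ) (L - a)

lemma pathDepth_sum_le {L : ℕ} (N : ℕ) (s : Finset (Fin (L + 1))) :
    ∑ a ∈ s, ((N : ℝ) / (N + 1)) ^ pathDepth a ≤ 4 * ((N : ℝ) + 1) := by
  have hz : (0 : ℝ) ≤ (N : ℝ) / (N + 1) := by positivity
  have h : ∀ a : Fin (L + 1), ((N : ℝ) / (N + 1)) ^ pathDepth a
      ≤ ((N : ℝ) / (N + 1)) ^ pathDist 0 a + ((N : ℝ) / (N + 1)) ^ pathDist (Fin.last L) a := by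
    intro a
    have ha := a.isLt
    rcases min_choice (a : ℕ) (L - a) with h | h
    · have : pathDepth a = pathDist 0 a := by
        rw [pathDepth, h]; simp [pathDist]
      rw [this]
      exact le_add_of_nonneg_right (by positivity)
    · have : pathDepth a = pathDist (Fin.last L) a := by
        rw [pathDepth, h, pathDist, Fin.val_last]; omega
      rw [this]
      exact le_add_of_nonneg_left (by positivity)
  refine (Finset.sum_le_sum fun a _ => h a).trans ?_
  rw [Finset.sum_add_distrib]
  linarith [pathDist_sum_le N s 0, pathDist_sum_le N s (Fin.last L)]

/-- The decay of the overlap with a fixed boundary condition. -/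
lemma overlap_le_of_cubeBoundary {d L : ℕ} (hd : 1 ≤ d) (hL : 3 ≤ L)
    [Fintype (cube d L).edgeSet] (γ : cubeBoundary d L → ℤˣ) (N : ℕ) :
    (∑ i ∈ Fintype.piFinset fun _ : Fin d => pathInterior L,
      ∑ j ∈ Fintype.piFinset fun _ : Fin d => pathInterior L,
        correlation (pairSpin (cube d L) (cubeBoundary d L) γ i j) (keptVar N ∅) (freshVar N ∅))
        / ((Fintype.piFinset fun _ : Fin d => pathInterior L).card : ℝ) ^ 2
      ≤ (4 + 8 * d) * (((N : ℝ) + 1) / L) ^ 1 := by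
  set W := Fintype.piFinset fun _ : Fin d => pathInterior L with hW
  set q : ℝ := (N : ℝ) / (N + 1) with hq
  have hq0 : 0 ≤ q := by positivity
  obtain ⟨e, rfl⟩ : ∃ e, d = e + 1 := ⟨d - 1, by omega⟩
  have hterm : ∀ i j : Fin (e + 1) → Fin (L + 1),
      correlation (pairSpin (cube (e + 1) L) (cubeBoundary (e + 1) L) γ i j)
        (keptVar N ∅) (freshVar N ∅)
        ≤ q ^ pathDist (i 0) (j 0) + ∑ c, q ^ pathDepth (i c) := by
    intro i j
    -- The coordinate `c` realizes the depth of `i` below the boundary. Sites of small depth limit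
    -- the rate to the first power of `(N+1)/L` anyway, so it suffices to measure the distance to
    -- `j` along coordinate `0`.
    obtain ⟨c, -, hc⟩ := Finset.exists_min_image Finset.univ (fun c => pathDepth (i c))
      ⟨0, Finset.mem_univ _⟩
    have hq1 : q ≤ 1 := by rw [hq, div_le_one (by positivity)]; linarith
    have hS : 0 ≤ ∑ c, q ^ pathDepth (i c) := Finset.sum_nonneg fun c _ => by positivity
    have hle : ∀ (x : Fin (e + 1) → Fin (L + 1)) (c : Fin (e + 1)),
        pathDist (i c) (x c) ≤ sumDist pathDist i x := fun x c =>
      Finset.single_le_sum (f := fun c => pathDist (i c) (x c)) (fun _ _ => Nat.zero_le _)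
        (Finset.mem_univ c)
    refine (correlation_pairSpin_le (cube (e + 1) L) γ (ρ := sumDist pathDist i)
      (m := min (pathDist (i 0) (j 0)) (pathDepth (i c))) (fun x y => cube_sumDist i x y)
      (by simp [sumDist, pathDist]) ((min_le_left _ _).trans (hle j 0))
      (fun x hx => ?_) N).trans ?_
    · obtain ⟨c', hc'⟩ := hx
      refine (min_le_right _ _).trans ((hc c' (Finset.mem_univ _)).trans (le_trans ?_ (hle x c')))
      have := (i c').isLt
      simp only [pathDepth, pathDist]
      omega
    · rcases min_choice (pathDist (i 0) (j 0)) (pathDepth (i c)) with h | h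
      · rw [h]; exact le_add_of_nonneg_right hS
      · rw [h]
        refine le_add_of_nonneg_of_le (by positivity) ?_
        exact Finset.single_le_sum (f := fun c => q ^ pathDepth (i c))
          (fun _ _ => by positivity) (Finset.mem_univ c)
  set S : ℝ := ((pathInterior L).card : ℝ) with hS
  have hS2 : (L : ℝ) ≤ 2 * S := by
    rw [hS, card_pathInterior]
    have : L ≤ 2 * (L - 1) := by omega
    exact_mod_cast this
  have hL0 : (0 : ℝ) < L := by positivity
  have hS0 : 0 < S := by linarith
  have hWc : (W.card : ℝ) = S ^ (e + 1) := by
    rw [hW, Fintype.card_piFinset_const]; push_cast; simp [hS]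
  have hn : (0 : ℝ) ≤ (N : ℝ) + 1 := by positivity
  have hsum : ∀ (φ : Fin (L + 1) → ℝ) (c : Fin (e + 1)),
      ∑ x ∈ W, φ (x c) = S ^ e * ∑ a ∈ pathInterior L, φ a := by
    intro φ c
    rw [hW, Fintype.sum_piFinset_apply, nsmul_eq_mul]
    simp [hS]
  have h1 : ∑ i ∈ W, ∑ j ∈ W, q ^ pathDist (i 0) (j 0)
      ≤ S ^ (e + 1) * (S ^ e * (2 * ((N : ℝ) + 1))) := by
    rw [← hWc, ← nsmul_eq_mul]
    refine Finset.sum_le_card_nsmul _ _ _ fun i _ => ?_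
    rw [hsum (fun a => q ^ pathDist (i 0) a) 0]
    exact mul_le_mul_of_nonneg_left (pathDist_sum_le N _ _) (by positivity)
  have h2 : ∑ i ∈ W, ∑ _j ∈ W, ∑ c, q ^ pathDepth (i c)
      ≤ S ^ (e + 1) * ((e + 1) * (S ^ e * (4 * ((N : ℝ) + 1)))) := by
    simp only [Finset.sum_const, nsmul_eq_mul, hWc]
    rw [← Finset.mul_sum]
    refine mul_le_mul_of_nonneg_left ?_ (by positivity)
    rw [Finset.sum_comm]
    refine (Finset.sum_le_card_nsmul Finset.univ _ (S ^ e * (4 * ((N : ℝ) + 1)))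
      fun c _ => ?_).trans_eq ?_
    · rw [hsum (fun a => q ^ pathDepth a) c]
      exact mul_le_mul_of_nonneg_left (pathDepth_sum_le N _) (by positivity)
    · simp
  have h3 : ∑ i ∈ W, ∑ j ∈ W,
      correlation (pairSpin (cube (e + 1) L) (cubeBoundary (e + 1) L) γ i j)
        (keptVar N ∅) (freshVar N ∅)
      ≤ S ^ (e + 1) * S ^ e * (2 + 4 * (e + 1)) * ((N : ℝ) + 1) := by
    refine (Finset.sum_le_sum fun i _ => Finset.sum_le_sum fun j _ => hterm i j).trans ?_
    simp only [Finset.sum_add_distrib]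
    refine (add_le_add h1 h2).trans_eq (by ring)
  rw [hWc, div_le_iff₀ (by positivity)]
  refine h3.trans ?_
  have h4 : S ^ (e + 1) * S ^ e * (2 + 4 * (e + 1)) * ((N : ℝ) + 1) * L
      ≤ S ^ (e + 1) * S ^ e * (2 + 4 * (e + 1)) * ((N : ℝ) + 1) * (2 * S) :=
    mul_le_mul_of_nonneg_left hS2 (by positivity)
  rw [← le_div_iff₀ hL0] at h4
  refine h4.trans_eq ?_
  push_cast
  rw [pow_one]
  field_simp
  ring

end Lattice

/-! ### Tail bounds for the random ground state. -/

section Conclusion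

/-- The tail bound for `F` without boundary. -/
lemma minCostRatio_real_le_of_free {d L : ℕ} {α : Type*} [Fintype α] (hd : 1 ≤ d) (hL : 2 ≤ L)
    (hα : L ≤ Fintype.card α) (hα' : Fintype.card α ≤ L + 1) (G : SimpleGraph (Fin d → α))
    (hG : ∀ g : (Fin d → α) → ℤˣ, (∀ x y, G.Adj x y → g x = g y) → ∀ x y, g x = g y)
    {δ : α → α → ℕ} (hδ0 : ∀ a, δ a a = 0)
    (hδ : ∀ z x y, G.Adj x y → sumDist δ z y ≤ sumDist δ z x + 1)
    (hs : ∀ (N : ℕ) a, ∑ a', ((N : ℝ) / (N + 1)) ^ δ a a' ≤ 2 * ((N : ℝ) + 1))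
    {K : ℝ} (hK : 0 < K) {Ω : Type*} [MeasurableSpace Ω] {P : Measure Ω} [IsProbabilityMeasure P]
    {γ : (∅ : Set (Fin d → α)) → ℤˣ} {J : Ω → G.edgeSet → ℝ} {σ : Ω → (Fin d → α) → ℤˣ}
    (h : IsRandomGroundState P G ∅ γ J σ) :
    P.real {ω | 8 * K * (L : ℝ) ^ (-(1 / 2) : ℝ) * √(Real.log L) ≤
        minCostRatio G ∅ (J ω) (σ ω)}
      ≤ (4 * 2 ^ d * (24 * d) ^ d + 4 * (12 * d) ^ d + 2 * (d.factorial / Real.log 2 ^ d) + 1)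
        * K ^ (-(max 2 d : ℕ) : ℤ) := by
  classical
  have hl2 : 0 < Real.log 2 := Real.log_pos one_lt_two
  set C : ℝ := 4 * 2 ^ d * (24 * d) ^ d + 4 * (12 * d) ^ d + 2 * (d.factorial / Real.log 2 ^ d)
    with hC
  have hC0 : 0 ≤ C := by positivity
  rw [zpow_neg, zpow_natCast, ← div_eq_mul_inv]
  -- For `K ≤ 1` the bound exceeds `1`, owing to the extra `+ 1` in the constant. For `K ≥ 1` the
  -- overlap bound gives the exponent `2d`, which is at least `max 2 d`.
  rcases le_total K 1 with hK1 | hK1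
  · refine measureReal_le_one.trans ?_
    rw [le_div_iff₀ (by positivity), one_mul]
    exact (pow_le_one₀ hK.le hK1).trans (by linarith)
  · have : Nonempty α := Fintype.card_pos_iff.1 (by omega)
    refine h.real_le.trans ((costlyEnvironments_real_le_of_overlap G γ (W := Finset.univ)
      (by simp) Finset.univ_nonempty hG hd le_rfl hL ?_ (a := 2 ^ d) (by positivity)
      (fun N => overlap_le_of_sumDist (by omega) hα G rfl γ hδ0 hδ (hs N)) hK).trans ?_)
    · rw [Fintype.card_fun, Fintype.card_fin]
      exact Nat.pow_le_pow_left hα' d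
    · rw [← hC, ← pow_mul]
      refine div_le_div₀ (by linarith) (by linarith) (by positivity) ?_
      exact pow_le_pow_right₀ hK1 (by omega)

/-- The tail bound for `F` with a fixed boundary condition. -/
lemma minCostRatio_real_le_of_boundary {d L : ℕ} (hd : 1 ≤ d) (hL : 3 ≤ L)
    {K : ℝ} (hK : 0 < K) {Ω : Type*} [MeasurableSpace Ω] {P : Measure Ω} [IsProbabilityMeasure P]
    {γ : cubeBoundary d L → ℤˣ} {J : Ω → (cube d L).edgeSet → ℝ}
    {σ : Ω → (Fin d → Fin (L + 1)) → ℤˣ}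
    (h : IsRandomGroundState P (cube d L) (cubeBoundary d L) γ J σ) :
    P.real {ω | 8 * K * (L : ℝ) ^ (-(1 / 2) : ℝ) * √(Real.log L) ≤
        minCostRatio (cube d L) (cubeBoundary d L) (J ω) (σ ω)}
      ≤ (4 * (4 + 8 * d) * (24 * d) ^ 1 + 4 * (12 * d) ^ 1
          + 2 * (d.factorial / Real.log 2 ^ d)) * K ^ (-2 : ℤ) := by
  classical
  have hW0 : (Fintype.piFinset fun _ : Fin d => pathInterior L).Nonempty := by
    rw [Fintype.piFinset_nonempty]
    intro _
    rw [← Finset.card_pos, card_pathInterior]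
    omega
  refine h.real_le.trans ((costlyEnvironments_real_le_of_overlap (cube d L) γ
    (coe_piFinset_pathInterior d L) hW0 (fun g => cube_connected d L g) hd hd (by omega)
    (by simp) (by positivity) (overlap_le_of_cubeBoundary hd hL γ) hK).trans_eq ?_)
  rw [zpow_neg, ← div_eq_mul_inv, pow_one (K ^ 2)]
  rfl

end Conclusion

end

end EdwardsAnderson

theorem mainTheorem9 :
    ∃ C₁ : ℝ, 0 < C₁ ∧ ∀ d : ℕ, 1 ≤ d → ∃ C₂ : ℝ, 0 < C₂ ∧
      -- the cube with the usual boundary and an arbitrary fixed boundary condition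
      (∀ (L : ℕ), 3 ≤ L → ∀ (γ : EdwardsAnderson.cubeBoundary d L → ℤˣ) (K : ℝ), 0 < K →
        ∀ (Ω : Type*) [MeasurableSpace Ω] (P : Measure Ω) [IsProbabilityMeasure P]
          (J : Ω → (EdwardsAnderson.cube d L).edgeSet → ℝ)
          (σ : Ω → (Fin d → Fin (L + 1)) → ℤˣ),
          EdwardsAnderson.IsRandomGroundState P (EdwardsAnderson.cube d L)
            (EdwardsAnderson.cubeBoundary d L) γ J σ →
          P.real {ω | C₁ * K * (L : ℝ) ^ (-(1 / 2) : ℝ) * √(Real.log L) ≤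
            EdwardsAnderson.minCostRatio (EdwardsAnderson.cube d L)
              (EdwardsAnderson.cubeBoundary d L) (J ω) (σ ω)} ≤ C₂ * K ^ (-2 : ℤ)) ∧
      -- the cube with free boundary
      (∀ (L : ℕ), 2 ≤ L → ∀ (K : ℝ), 0 < K →
        ∀ (Ω : Type*) [MeasurableSpace Ω] (P : Measure Ω) [IsProbabilityMeasure P]
          (J : Ω → (EdwardsAnderson.cube d L).edgeSet → ℝ)
          (σ : Ω → (Fin d → Fin (L + 1)) → ℤˣ),
          EdwardsAnderson.IsRandomGroundState P (EdwardsAnderson.cube d L) ∅ isEmptyElim J σ →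
          P.real {ω | C₁ * K * (L : ℝ) ^ (-(1 / 2) : ℝ) * √(Real.log L) ≤
            EdwardsAnderson.minCostRatio (EdwardsAnderson.cube d L) ∅ (J ω) (σ ω)}
              ≤ C₂ * K ^ (-(max 2 d : ℕ) : ℤ)) ∧
      -- the cube with periodic boundary
      (∀ (L : ℕ) [NeZero L], 2 ≤ L → ∀ (K : ℝ), 0 < K →
        ∀ (Ω : Type*) [MeasurableSpace Ω] (P : Measure Ω) [IsProbabilityMeasure P]
          (J : Ω → (EdwardsAnderson.torus d L).edgeSet → ℝ)
          (σ : Ω → (Fin d → ZMod L) → ℤˣ),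
          EdwardsAnderson.IsRandomGroundState P (EdwardsAnderson.torus d L) ∅ isEmptyElim J σ →
          P.real {ω | C₁ * K * (L : ℝ) ^ (-(1 / 2) : ℝ) * √(Real.log L) ≤
            EdwardsAnderson.minCostRatio (EdwardsAnderson.torus d L) ∅ (J ω) (σ ω)}
              ≤ C₂ * K ^ (-(max 2 d : ℕ) : ℤ)) := by
  refine ⟨8, by norm_num, fun d hd => ?_⟩
  have hl2 : 0 < Real.log 2 := Real.log_pos one_lt_two
  set a : ℝ := 4 * (4 + 8 * d) * (24 * d) ^ 1 + 4 * (12 * d) ^ 1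
    + 2 * (d.factorial / Real.log 2 ^ d) with ha
  set b : ℝ := 4 * 2 ^ d * (24 * d) ^ d + 4 * (12 * d) ^ d
    + 2 * (d.factorial / Real.log 2 ^ d) + 1 with hb
  have ha0 : 0 ≤ a := by positivity
  have hb0 : 0 < b := by positivity
  refine ⟨a + b, by positivity, ?_, ?_, ?_⟩
  · intro L hL γ K hK Ω _ P _ J σ h
    refine (EdwardsAnderson.minCostRatio_real_le_of_boundary hd hL hK h).trans ?_
    exact mul_le_mul_of_nonneg_right (by linarith) (by positivity)
  · intro L hL K hK Ω _ P _ J σ h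
    refine (EdwardsAnderson.minCostRatio_real_le_of_free (δ := EdwardsAnderson.pathDist) hd hL
      (by simp) (by simp) _ (fun g => EdwardsAnderson.cube_connected d L g)
      (fun a => by simp [EdwardsAnderson.pathDist]) EdwardsAnderson.cube_sumDist
      (fun N a => EdwardsAnderson.pathDist_sum_le N _ a) hK h).trans ?_
    exact mul_le_mul_of_nonneg_right (by linarith) (by positivity)
  · intro L _ hL K hK Ω _ P _ J σ h
    refine (EdwardsAnderson.minCostRatio_real_le_of_free (δ := EdwardsAnderson.cycleDist) hd hL
      (by rw [ZMod.card]) (by rw [ZMod.card]; omega) _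
      (fun g => EdwardsAnderson.torus_connected d L g)
      (fun a => by simp [EdwardsAnderson.cycleDist]) EdwardsAnderson.torus_sumDist
      (fun N a => EdwardsAnderson.cycleDist_sum_le N a) hK h).trans ?_
    exact mul_le_mul_of_nonneg_right (by linarith) (by positivity)
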